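/- For a closed planar curve $f\colon \mathbf{R}/L\mathbf{Z}\to\mathbf{R}^2$ parametrized by arc length (i.e. for every interval the length of the restriction of $f$ to it equals the length of the interval), let $$TD(f):=\int_0^L\|f(t+L/2)-f(t)\|\,dt,\qquad A(f):=\int_{\mathbf{R}^2} w_2(f,x)\,dx,$$ where $w_2(f,x)\in\{0,1\}$ is the winding number mod $2$ of $f$ about $x\notin f(\mathbf{R}/L\mathbf{Z})$, i.e. the degree mod $2$ of $t\mapsto (f(t)-x)/\|f(t)-x\|$ (the points $x$ of the trace of $f$ form a null set and contribute nothing); if $f$ is simple, $A(f)$ is the area of the region enclosed by $f$. For an integer $n\ge 1$ put $$R:=\frac1n+\frac1{2n^2},\qquad h:=\frac1{2n^2},\qquad r:=\frac{\pi R+1/n^2}{\pi+2},$$ and let $C_n\subset\mathbf{R}^2$ be the horseshoe outline that consists of: the two rectangular parts, i.e. the segments $[(-1,R),(0,R)]$, $[(-1,h),(0,h)]$, $[(-1,h),(-1,R)]$ and their mirror images in the $x$-axis; the concentric semicircles of radii $R$ and $r$ about the origin in the half-plane $x\ge 0$; and the segments $[(0,h),(0,r)]$ and $[(0,-r),(0,-h)]$.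 Then there are simple closed planar curves $f_n\colon\mathbf{R}/L_n\mathbf{Z}\to\mathbf{R}^2$, $n=1,2,\dots$, parametrized by arc length, whose trace is $C_n$, such that for every $n\ge 1$ $$A(f_n)\ge\frac2n,\qquad 2A(f_n)\le TD(f_n)\le 2A(f_n)+\frac{94}{n^2},$$ and consequently $$\lim_{n\to\infty}\frac{TD(f_n)}{A(f_n)}=2 .$$ In particular, the constant $2$ in the inequality $TD\ge 2A$ is sharp even for simple curves: if a real number $c$ satisfies $TD(f)\ge c\,A(f)$ for all simple closed planar curves $f$ parametrized by arc length, then $c\le 2$. Moreover $TD(f_n)<4A(f_n)$ for all sufficiently large $n$, so that the inequality $TD\ge 4A$, which is valid for convex or centrally symmetric closed planar curves, fails in general for simple closed curves. -/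

import Mathlib

open MeasureTheory Filter Topology

noncomputable section

/-- The Euclidean plane. -/
abbrev Plane : Type := EuclideanSpace ℝ (Fin 2)

/-- `γ : ℝ → Plane` is (the periodic lift of) a simple closed curve `ℝ / Lℤ → Plane` parametrized
by arc length: `γ` is `L`-periodic, injective on a period, and for every interval the length of the
restriction of `γ` to it equals the length of the interval. -/
structure IsSimpleClosedUnitSpeed (γ : ℝ → Plane) (L : ℝ) : Prop where
  length_pos : 0 < L
  periodic : Function.Periodic γ L
  simple : Set.InjOn γ (Set.Ico 0 L)
  unitSpeed : HasUnitSpeedOn γ Set.univ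

/-- The total diameter of an `L`-periodic curve: the integral over a period of the length of the
antipodal chord joining `γ t` to `γ (t + L / 2)`. -/
def totalDiameter (γ : ℝ → Plane) (L : ℝ) : ℝ :=
  ∫ t in (0 : ℝ)..L, ‖γ (t + L / 2) - γ t‖

/-- The `L`-periodic map `r` takes values in the unit circle and has degree `k`: it has a continuous
angle function, whose total increment over a period is `2πk`. -/
def HasDegree (r : ℝ → Plane) (L : ℝ) (k : ℤ) : Prop :=
  ∃ θ : ℝ → ℝ, Continuous θ ∧ (∀ t, r t = !₂[Real.cos (θ t), Real.sin (θ t)]) ∧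
    θ L - θ 0 = 2 * Real.pi * k

/-- The degree is unique. -/
theorem HasDegree.unique {r : ℝ → Plane} {L : ℝ} {k l : ℤ}
    (hk : HasDegree r L k) (hl : HasDegree r L l) : k = l := by
  obtain ⟨θ, hθ, hr, hk⟩ := hk
  obtain ⟨η, hη, hs, hl⟩ := hl
  have key : ∀ t, ∃ n : ℤ, (n : ℝ) * (2 * Real.pi) = θ t - η t := by
    intro t
    have h := (hr t).symm.trans (hs t)
    have h0 : Real.cos (θ t) = Real.cos (η t) := by simpa using congrArg (fun v : Plane => v 0) h
    have h1 : Real.sin (θ t) = Real.sin (η t) := by simpa using congrArg (fun v : Plane => v 1) h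
    refine (Real.cos_eq_one_iff _).1 ?_
    rw [Real.cos_sub, h0, h1]
    nlinarith [Real.sin_sq_add_cos_sq (η t)]
  choose n hn using key
  have hπ : (2 * Real.pi) ≠ 0 := by positivity
  have hcast : Continuous fun t => (n t : ℝ) := by
    have : (fun t => (n t : ℝ)) = fun t => (θ t - η t) / (2 * Real.pi) := by
      funext t
      rw [← hn t, mul_div_cancel_right₀ _ hπ]
    rw [this]
    fun_prop
  have hcont : Continuous n := Int.isClosedEmbedding_coe_real.isInducing.continuous_iff.2 hcast
  have hconst : n L = n 0 := PreconnectedSpace.constant inferInstance hcont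
  have h2 := hn L
  have h3 := hn 0
  rw [hconst] at h2
  have h4 : 2 * Real.pi * (k : ℝ) = 2 * Real.pi * l := by linarith
  exact_mod_cast mul_left_cancel₀ hπ h4

open Classical in
/-- The degree mod 2 of an `L`-periodic map `r` into the unit circle, as the number `0` or `1`
(and `0` if `r` is not a continuous map into the unit circle). -/
def degMod2 (r : ℝ → Plane) (L : ℝ) : ℕ :=
  if ∃ k : ℤ, HasDegree r L k ∧ Odd k then 1 else 0

/-- The winding number mod 2 of an `L`-periodic curve `γ` about the point `x`, i.e. the degree mod 2
of `(γ - x) / ‖γ - x‖`. It is `0` by convention at points of the curve, where that quotient takes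
the value `0`, off the unit circle. -/
def windingMod2 (γ : ℝ → Plane) (L : ℝ) (x : Plane) : ℕ :=
  degMod2 (fun t => ‖γ t - x‖⁻¹ • (γ t - x)) L

/-- The area of a closed planar curve: the integral over the plane of its winding number mod 2. -/
def curveArea (γ : ℝ → Plane) (L : ℝ) : ℝ :=
  ∫ x : Plane, (windingMod2 γ L x : ℝ)

namespace Horseshoe

/-- Half of the vertical gap `1 / n ^ 2` between the two rectangular parts. -/
def halfGap (n : ℕ) : ℝ := 1 / (2 * (n : ℝ) ^ 2)

/-- The radius of the large semicircle. -/
def bigRadius (n : ℕ) : ℝ := 1 / (n : ℝ) + 1 / (2 * (n : ℝ) ^ 2)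

/-- The radius of the small semicircle. -/
def smallRadius (n : ℕ) : ℝ := (Real.pi * bigRadius n + 1 / (n : ℝ) ^ 2) / (Real.pi + 2)

/-- The right half of the circle of radius `ρ` about the origin. -/
def semicircle (ρ : ℝ) : Set Plane := {x | ‖x‖ = ρ ∧ 0 ≤ x 0}

/-- The horseshoe: the outline of two rectangles of length `1` and height `1 / n`, one above the
other at vertical distance `1 / n ^ 2`, whose right ends (on the line `x 0 = 0`) are joined by the
half annulus between two concentric semicircles. -/
def outline (n : ℕ) : Set Plane :=
  let h := halfGap n
  let R := bigRadius n
  let r := smallRadius n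
  segment ℝ !₂[-1, R] !₂[0, R] ∪ semicircle R ∪ segment ℝ !₂[0, -R] !₂[-1, -R] ∪
  segment ℝ !₂[-1, -R] !₂[-1, -h] ∪ segment ℝ !₂[-1, -h] !₂[0, -h] ∪
  segment ℝ !₂[0, -h] !₂[0, -r] ∪ semicircle r ∪ segment ℝ !₂[0, r] !₂[0, h] ∪
  segment ℝ !₂[0, h] !₂[-1, h] ∪ segment ℝ !₂[-1, h] !₂[-1, R]

end Horseshoe

end

/-! Let M be half the length of the outline, traversed from its rightmost point (R, 0). The outline
is symmetric in the first axis and its second half is the mirror image of the first run backwards,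
so the antipode of the point at time t ≤ M is the mirror image of the point of the upper half at
time M - t. The radius r is chosen so that an outer quarter arc, of length πR/2, is exactly as long
as an inner quarter arc together with the segment from (0, h) to (0, r). Hence t ↦ M - t maps the
time interval spent on the rectangle to itself and exchanges its long sides: the chord joins the
outer side of one rectangle to the inner side of the other, is vertical, and has length R + h, about
1/n instead of 2/n.

These chords contribute exactly 2(R + h)(2 + R - h) to the total diameter. The remaining time is
2πR, and then both ends lie in the disc of radius R, which costs at most 4πR². The area is 2(R - h)
= 2/n for the rectangles plus at most the half disc πR²/2. So TD and 2A are both 4/n + O(1/n²); the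
inequality 2A ≤ TD for these curves also follows from the explicit bounds (`totalDiameter_bounds`,
`curveArea_bounds`).

Two points need care. Arc length is checked locally: a continuous map with one-sided derivatives of
norm one everywhere has unit speed (`hasUnitSpeedOn`), and this condition survives gluing at
corners. The winding number is found by exhibiting angle functions: `hasDegree_of_ne_opposite` turns
any rough angle that is never opposite to the true direction into a genuine one. It gives degree one
at one point of the upper rectangle and degree zero where a ray or half-plane avoids the curve;
connectedness spreads these values over the complement. -/

/-! ### Arc length from one-sided derivatives. -/

/-- `f` is continuous and has one-sided derivatives of norm one at every point. -/
structure HasUnitOneSidedDerivs {E : Type*} [NormedAddCommGroup E] [NormedSpace ℝ E]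
    (f : ℝ → E) : Prop where
  continuous : Continuous f
  right : ∀ t, ∃ v, ‖v‖ = 1 ∧ HasDerivWithinAt f v (Set.Ici t) t
  left : ∀ t, ∃ v, ‖v‖ = 1 ∧ HasDerivWithinAt f v (Set.Iic t) t

namespace HasUnitOneSidedDerivs

variable {E : Type*} [NormedAddCommGroup E] [NormedSpace ℝ E] {f g : ℝ → E}

theorem of_hasDerivAt {f' : ℝ → E} (h : ∀ t, HasDerivAt f (f' t) t) (h1 : ∀ t, ‖f' t‖ = 1) :
    HasUnitOneSidedDerivs f :=
  ⟨continuous_iff_continuousAt.2 fun t => (h t).continuousAt,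
    fun t => ⟨_, h1 t, (h t).hasDerivWithinAt⟩, fun t => ⟨_, h1 t, (h t).hasDerivWithinAt⟩⟩

theorem comp_const_sub (hf : HasUnitOneSidedDerivs f) (c : ℝ) :
    HasUnitOneSidedDerivs fun t => f (c - t) := by
  have hd : ∀ t s, HasDerivWithinAt (fun t : ℝ => c - t) (-1) s t := fun t s => by
    simpa using! ((hasDerivAt_id t).const_sub c).hasDerivWithinAt
  refine ⟨hf.continuous.comp (by fun_prop), fun t => ?_, fun t => ?_⟩
  · obtain ⟨v, hv, h⟩ := hf.left (c - t)
    refine ⟨(-1 : ℝ) • v, by simpa using hv, ?_⟩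
    exact h.scomp t (hd t _) fun s hs => sub_le_sub_left (Set.mem_Ici.1 hs) c
  · obtain ⟨v, hv, h⟩ := hf.right (c - t)
    refine ⟨(-1 : ℝ) • v, by simpa using hv, ?_⟩
    exact h.scomp t (hd t _) fun s hs => sub_le_sub_left (Set.mem_Iic.1 hs) c

theorem comp_sub_const (hf : HasUnitOneSidedDerivs f) (c : ℝ) :
    HasUnitOneSidedDerivs fun t => f (t - c) := by
  simpa [Function.comp_def, sub_eq_add_neg, add_comm] using
    (hf.comp_const_sub (-c)).comp_const_sub 0

theorem linearIsometry_comp (hf : HasUnitOneSidedDerivs f) (σ : E →ₗᵢ[ℝ] E) :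
    HasUnitOneSidedDerivs fun t => σ (f t) := by
  refine ⟨σ.continuous.comp hf.continuous, fun t => ?_, fun t => ?_⟩
  · obtain ⟨v, hv, h⟩ := hf.right t
    exact ⟨σ v, by simpa using hv,
      σ.toContinuousLinearMap.hasFDerivAt.comp_hasDerivWithinAt t h⟩
  · obtain ⟨v, hv, h⟩ := hf.left t
    exact ⟨σ v, by simpa using hv,
      σ.toContinuousLinearMap.hasFDerivAt.comp_hasDerivWithinAt t h⟩

/-- Gluing two functions that agree at `c`. -/
theorem ite_lt (hf : HasUnitOneSidedDerivs f) (hg : HasUnitOneSidedDerivs g) {c : ℝ}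
    (h : f c = g c) : HasUnitOneSidedDerivs fun t => if t < c then f t else g t := by
  -- The strict form suits right derivatives; the non-strict form, equal because the values agree at
  -- c, suits left derivatives and continuity.
  have hle : (fun t => if t < c then f t else g t) = fun t => if t ≤ c then f t else g t := by
    funext t
    rcases lt_trichotomy t c with h1 | rfl | h1
    · simp [h1, h1.le]
    · simp [h]
    · simp [h1.not_gt, h1.not_ge]
  refine ⟨?_, fun t => ?_, fun t => ?_⟩
  · rw [hle]
    exact hf.continuous.if_le hg.continuous continuous_id continuous_const
      fun t ht => by rw [ht]; exact h
  · rcases lt_or_ge t c with h1 | h1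
    · obtain ⟨v, hv, hd⟩ := hf.right t
      refine ⟨v, hv, hd.congr_of_eventuallyEq ?_ (by simp [h1])⟩
      filter_upwards [mem_nhdsWithin_of_mem_nhds (Iio_mem_nhds h1)] with s hs
      exact if_pos hs
    · obtain ⟨v, hv, hd⟩ := hg.right t
      refine ⟨v, hv, hd.congr (fun s hs => if_neg ?_) (if_neg h1.not_gt)⟩
      exact not_lt.2 (h1.trans hs)
  · rw [hle]
    rcases le_or_gt t c with h1 | h1
    · obtain ⟨v, hv, hd⟩ := hf.left t
      refine ⟨v, hv, hd.congr (fun s hs => if_pos ?_) (if_pos h1)⟩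
      exact le_trans hs h1
    · obtain ⟨v, hv, hd⟩ := hg.left t
      refine ⟨v, hv, hd.congr_of_eventuallyEq ?_ (if_neg h1.not_ge)⟩
      filter_upwards [mem_nhdsWithin_of_mem_nhds (Ioi_mem_nhds h1)] with s hs
      exact if_neg (not_le.2 hs)

/-- The periodic extension of a function on `[0, L]` with equal values at the ends. -/
theorem comp_fract (hf : HasUnitOneSidedDerivs f) {L : ℝ} (hL : 0 < L) (h : f 0 = f L) :
    HasUnitOneSidedDerivs fun t => f (L * Int.fract (t / L)) := by
  have hfr : ∀ t, L * Int.fract (t / L) = t - L * ⌊t / L⌋ := fun t => by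
    rw [Int.fract]; field_simp
  refine ⟨?_, fun t => ?_, fun t => ?_⟩
  · have := ContinuousOn.comp_fract'' (f := fun u => f (L * u))
      (hf.continuous.comp (by fun_prop)).continuousOn (by simpa using h)
    exact this.comp (by fun_prop : Continuous fun t : ℝ => t / L)
  · obtain ⟨v, hv, hd⟩ := (hf.comp_sub_const (L * ⌊t / L⌋)).right t
    refine ⟨v, hv, hd.congr_of_eventuallyEq ?_ (by rw [hfr])⟩
    have h1 : t < L * (⌊t / L⌋ + 1) := by
      have := Int.lt_floor_add_one (t / L)
      rwa [div_lt_iff₀' hL] at this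
    filter_upwards [mem_nhdsWithin_of_mem_nhds (Iio_mem_nhds h1), self_mem_nhdsWithin] with s hs hs'
    have : ⌊s / L⌋ = ⌊t / L⌋ := by
      refine Int.floor_eq_iff.2 ⟨(Int.floor_le _).trans ?_, ?_⟩
      · exact div_le_div_of_nonneg_right hs' hL.le
      · rwa [div_lt_iff₀' hL]
    rw [hfr, this]
  -- From the left the relevant period is (Lk, L(k + 1)]; the floor would pick the wrong one when t
  -- is a multiple of L. At the closed end `Int.fract` jumps to 0, and f 0 = f L repairs this.
  · set k : ℤ := ⌈t / L⌉ - 1 with hk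
    have hk1 : L * k < t := by
      have := Int.ceil_lt_add_one (t / L)
      rw [← sub_lt_iff_lt_add, lt_div_iff₀' hL] at this
      simpa [hk] using this
    have hk2 : t ≤ L * (k + 1) := by
      have := Int.le_ceil (t / L)
      rw [div_le_iff₀' hL] at this
      simpa [hk] using this
    have heq : ∀ s, L * k < s → s ≤ t → f (L * Int.fract (s / L)) = f (s - L * k) := by
      intro s hs hst
      rcases (hst.trans hk2).lt_or_eq with h1 | h1
      · have : ⌊s / L⌋ = k := by
          refine Int.floor_eq_iff.2 ⟨?_, ?_⟩
          · rw [le_div_iff₀' hL]; exact hs.le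
          · rwa [div_lt_iff₀' hL]
        rw [hfr, this]
      · have h2 : s / L = ((k + 1 : ℤ) : ℝ) := by
          rw [h1]; push_cast; field_simp
        rw [h2, Int.fract_intCast, mul_zero, h, h1]
        congr 1; ring
    obtain ⟨v, hv, hd⟩ := (hf.comp_sub_const (L * k)).left t
    refine ⟨v, hv, hd.congr_of_eventuallyEq ?_ (heq t hk1 le_rfl)⟩
    filter_upwards [mem_nhdsWithin_of_mem_nhds (Ioi_mem_nhds hk1), self_mem_nhdsWithin] with s hs hs'
    exact heq s hs hs'

theorem norm_sub_le (hf : HasUnitOneSidedDerivs f) {a b : ℝ} (hab : a ≤ b) :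
    ‖f b - f a‖ ≤ b - a := by
  choose f' h1 hd using hf.right
  simpa using norm_image_sub_le_of_norm_deriv_right_le_segment (C := 1) hf.continuous.continuousOn
    (fun x _ => hd x) (fun x _ => (h1 x).le) b ⟨hab, le_rfl⟩

theorem lipschitzWith (hf : HasUnitOneSidedDerivs f) : LipschitzWith 1 f := by
  refine LipschitzWith.of_dist_le_mul fun a b => ?_
  rw [NNReal.coe_one, one_mul, dist_eq_norm, Real.dist_eq]
  rcases le_total a b with h | h
  · rw [norm_sub_rev, abs_sub_comm, abs_of_nonneg (sub_nonneg.2 h)]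
    exact hf.norm_sub_le h
  · rw [abs_of_nonneg (sub_nonneg.2 h)]
    exact hf.norm_sub_le h

/-- The variation over [x, y] lies between the distance of the endpoints and y - x. To first order
both bounds agree since the derivative has norm one, so the variation minus the time has right
derivative zero and is constant. -/
theorem hasUnitSpeedOn (hf : HasUnitOneSidedDerivs f) : HasUnitSpeedOn f Set.univ := by
  have hbv : LocallyBoundedVariationOn f Set.univ :=
    hf.lipschitzWith.locallyBoundedVariationOn _
  have hlow : ∀ {x y : ℝ}, x ≤ y → ‖f y - f x‖ ≤ variationOnFromTo f Set.univ x y := by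
    intro x y hxy
    rw [variationOnFromTo.eq_of_le _ _ hxy, Set.univ_inter, ← dist_eq_norm]
    have hne : eVariationOn f (Set.Icc x y) ≠ ⊤ := by
      have := hbv x y (Set.mem_univ _) (Set.mem_univ _)
      rwa [Set.univ_inter] at this
    rw [← ENNReal.ofReal_le_iff_le_toReal hne, ← edist_dist]
    exact eVariationOn.edist_le f ⟨hxy, le_rfl⟩ ⟨le_rfl, hxy⟩
  have hup : ∀ {x y : ℝ}, x ≤ y → variationOnFromTo f Set.univ x y ≤ y - x := by
    intro x y hxy
    rw [variationOnFromTo.eq_of_le _ _ hxy, Set.univ_inter]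
    refine ENNReal.toReal_le_of_le_ofReal (sub_nonneg.2 hxy) ?_
    have h1 := (hf.lipschitzWith.lipschitzOnWith (s := Set.univ)).comp_eVariationOn_le
      (g := fun t : ℝ => t) (s := Set.Icc x y) (fun _ _ => Set.mem_univ _)
    have h2 := (monotone_id (α := ℝ)).monotoneOn (Set.Icc x y) |>.eVariationOn_eq
      (a := x) (b := y) ⟨le_rfl, hxy⟩ ⟨hxy, le_rfl⟩
    rw [Set.inter_self] at h2
    refine h1.trans ?_
    rw [ENNReal.coe_one, one_mul]
    exact h2.le
  have hadd : ∀ x y z : ℝ, variationOnFromTo f Set.univ x y + variationOnFromTo f Set.univ y z =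
      variationOnFromTo f Set.univ x z := fun x y z =>
    variationOnFromTo.add hbv (Set.mem_univ _) (Set.mem_univ _) (Set.mem_univ _)
  refine hasConstantSpeedOnWith_iff_ordered.2 fun x _ y _ hxy => ?_
  have key : variationOnFromTo f Set.univ x y = y - x := by
    set W : ℝ → ℝ := fun t => variationOnFromTo f Set.univ x t - t with hW
    have hWlip : LipschitzWith 1 W := by
      refine LipschitzWith.of_dist_le_mul fun a b => ?_
      wlog hab : a ≤ b generalizing a b
      · rw [dist_comm, dist_comm a b]; exact this b a (le_of_not_ge hab)
      have h1 := hadd x a b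
      have h2 := hup hab
      have h3 := (norm_nonneg _).trans (hlow hab)
      rw [NNReal.coe_one, one_mul, Real.dist_eq, Real.dist_eq, abs_sub_comm a b,
        abs_of_nonneg (sub_nonneg.2 hab), abs_le]
      simp only [hW]
      constructor <;> linarith
    have := constant_of_has_deriv_right_zero (f := W) (a := x) (b := y)
      hWlip.continuous.continuousOn (fun t _ => ?_) y ⟨hxy, le_rfl⟩
    · simp only [hW, variationOnFromTo.self] at this
      linarith
    · obtain ⟨v, hv, hd⟩ := hf.right t
      rw [hasDerivWithinAt_iff_isLittleO] at hd ⊢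
      refine Asymptotics.IsBigO.trans_isLittleO (Asymptotics.IsBigO.of_bound 1 ?_) hd
      filter_upwards [self_mem_nhdsWithin] with s (hs : t ≤ s)
      have h1 := hadd x t s
      have h2 := hup hs
      have h3 := hlow hs
      -- Squeezes the defect (s - t) minus variation between 0 and the remainder ‖f s - f t - (s -
      -- t) • v‖, which is o(s - t).
      have h4 : s - t ≤ ‖f s - f t‖ + ‖f s - f t - (s - t) • v‖ := by
        have := norm_sub_norm_le ((s - t) • v) (f s - f t)
        rw [norm_smul, hv, mul_one, Real.norm_of_nonneg (sub_nonneg.2 hs),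
          norm_sub_rev ((s - t) • v)] at this
        linarith
      rw [smul_zero, sub_zero, one_mul, Real.norm_eq_abs, abs_le]
      simp only [hW]
      constructor <;> linarith [norm_nonneg (f s - f t - (s - t) • v)]
  rw [variationOnFromTo.eq_of_le _ _ hxy] at key
  have hne : eVariationOn f (Set.univ ∩ Set.Icc x y) ≠ ⊤ :=
    hbv x y (Set.mem_univ _) (Set.mem_univ _)
  rw [NNReal.coe_one, one_mul, ← key, ENNReal.ofReal_toReal hne]

end HasUnitOneSidedDerivs

/-! ### Degrees and winding numbers of closed curves. -/

theorem Plane.mk_zero (a b : ℝ) : (!₂[a, b] : Plane) 0 = a := rfl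

theorem Plane.mk_one (a b : ℝ) : (!₂[a, b] : Plane) 1 = b := rfl

theorem Plane.norm_sq (x : Plane) : ‖x‖ ^ 2 = x 0 ^ 2 + x 1 ^ 2 := by
  rw [EuclideanSpace.norm_sq_eq, Fin.sum_univ_two, Real.norm_eq_abs, Real.norm_eq_abs, sq_abs,
    sq_abs]

theorem Plane.ext' {x y : Plane} (h0 : x 0 = y 0) (h1 : x 1 = y 1) : x = y := by
  ext i; fin_cases i <;> assumption

/-- If the direction of `γ - x` is never opposite to the direction with angle `ψ`, then the degree
is read off from `ψ`. -/
theorem hasDegree_of_ne_opposite {γ : ℝ → Plane} {L : ℝ} (hL : 0 < L) (hγ : Continuous γ)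
    (hper : Function.Periodic γ L) {x : Plane} {ψ : ℝ → ℝ} (hψ : Continuous ψ) {k : ℤ}
    (hk : ψ L - ψ 0 = 2 * Real.pi * k)
    (h : ∀ t ∈ Set.Icc 0 L,
      0 < (γ t 0 - x 0) * Real.cos (ψ t) + (γ t 1 - x 1) * Real.sin (ψ t) ∨
        (γ t 1 - x 1) * Real.cos (ψ t) - (γ t 0 - x 0) * Real.sin (ψ t) ≠ 0) :
    HasDegree (fun t => ‖γ t - x‖⁻¹ • (γ t - x)) L k := by
  -- The vector γ t - x rotated by -ψ t. The hypothesis says that it avoids the closed negative real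
  -- axis, where `Complex.arg` fails to be continuous; ψ + arg z is then a continuous angle.
  set z : ℝ → ℂ := fun t =>
    ⟨(γ t 0 - x 0) * Real.cos (ψ t) + (γ t 1 - x 1) * Real.sin (ψ t),
      (γ t 1 - x 1) * Real.cos (ψ t) - (γ t 0 - x 0) * Real.sin (ψ t)⟩ with hz
  have hzc : Continuous z := by
    have h0 : Continuous fun t => γ t 0 := by fun_prop
    have h1 : Continuous fun t => γ t 1 := by fun_prop
    have : z = fun t => (((γ t 0 - x 0) * Real.cos (ψ t) + (γ t 1 - x 1) * Real.sin (ψ t) : ℝ) : ℂ)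
        + (((γ t 1 - x 1) * Real.cos (ψ t) - (γ t 0 - x 0) * Real.sin (ψ t) : ℝ) : ℂ)
          * Complex.I := by
      funext t
      apply Complex.ext <;> simp [hz, -Complex.ofReal_cos, -Complex.ofReal_sin]
    rw [this]
    fun_prop
  have hslit : ∀ t ∈ Set.Icc 0 L, z t ∈ Complex.slitPlane := fun t ht =>
    Complex.mem_slitPlane_iff.2 (h t ht)
  -- The angle with its linear growth removed takes equal values at both ends of a period. It can
  -- thus be extended periodically by `Int.fract`, and no hypothesis on ψ outside [0, L] is needed.
  set q : ℝ → ℝ := fun u => ψ (L * u) + (z (L * u)).arg - 2 * Real.pi * k * u with hq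
  have hmaps : ∀ u ∈ Set.Icc (0 : ℝ) 1, L * u ∈ Set.Icc 0 L := fun u hu =>
    ⟨mul_nonneg hL.le hu.1, mul_le_of_le_one_right hL.le hu.2⟩
  have hqc : ContinuousOn q (Set.Icc 0 1) := by
    intro u hu
    refine ContinuousAt.continuousWithinAt ?_
    have h1 : ContinuousAt (fun u => (z (L * u)).arg) u :=
      ContinuousAt.comp (f := fun u => z (L * u))
        (Complex.continuousAt_arg (hslit _ (hmaps u hu))) (hzc.comp (by fun_prop)).continuousAt
    have h2 : ContinuousAt (fun u => ψ (L * u)) u := (hψ.comp (by fun_prop)).continuousAt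
    exact (h2.add h1).sub (by fun_prop)
  have hzL : z L = z 0 := by
    have hc : Real.cos (ψ L) = Real.cos (ψ 0) := by
      rw [show ψ L = ψ 0 + k * (2 * Real.pi) by linarith, Real.cos_add_int_mul_two_pi]
    have hs : Real.sin (ψ L) = Real.sin (ψ 0) := by
      rw [show ψ L = ψ 0 + k * (2 * Real.pi) by linarith, Real.sin_add_int_mul_two_pi]
    have hg : γ L = γ 0 := by simpa using hper 0
    simp only [hz, hc, hs, hg]
  have hq01 : q 0 = q 1 := by
    simp only [hq, mul_zero, mul_one, hzL]
    linarith
  refine ⟨fun t => 2 * Real.pi * k * (t / L) + q (Int.fract (t / L)), ?_, fun t => ?_, ?_⟩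
  · have := (hqc.comp_fract'' hq01).comp (by fun_prop : Continuous fun t : ℝ => t / L)
    exact (by fun_prop : Continuous fun t : ℝ => 2 * Real.pi * k * (t / L)).add this
  · set u := Int.fract (t / L) with hu
    have hu01 : u ∈ Set.Icc (0 : ℝ) 1 := ⟨Int.fract_nonneg _, (Int.fract_lt_one _).le⟩
    have ht : γ t = γ (L * u) := by
      have h1 : L * u = t - ⌊t / L⌋ * L := by
        rw [hu, Int.fract]; field_simp
      rw [h1, hper.sub_int_mul_eq]
    have hθ : 2 * Real.pi * k * (t / L) + q u =
        ψ (L * u) + (z (L * u)).arg + ((k * ⌊t / L⌋ : ℤ) : ℝ) * (2 * Real.pi) := by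
      have h1 : t / L = ⌊t / L⌋ + u := (Int.floor_add_fract _).symm
      simp only [hq]
      conv_lhs => rw [h1]
      push_cast
      ring
    have hmem := hslit _ (hmaps u hu01)
    have hz0 : z (L * u) ≠ 0 := Complex.slitPlane_ne_zero hmem
    have hsc := Real.sin_sq_add_cos_sq (ψ (L * u))
    have hnorm : ‖z (L * u)‖ = ‖γ t - x‖ := by
      rw [← sq_eq_sq₀ (norm_nonneg _) (norm_nonneg _), Plane.norm_sq, ← Complex.normSq_eq_norm_sq,
        Complex.normSq_apply, ht]
      simp only [hz, PiLp.sub_apply]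
      linear_combination ((γ (L * u) 0 - x 0) ^ 2 + (γ (L * u) 1 - x 1) ^ 2) * hsc
    have hpos : ‖γ t - x‖ ≠ 0 := by rw [← hnorm]; simpa using hz0
    change ‖γ t - x‖⁻¹ • (γ t - x) = !₂[Real.cos (2 * Real.pi * k * (t / L) + q u),
      Real.sin (2 * Real.pi * k * (t / L) + q u)]
    rw [hθ, Real.cos_add_int_mul_two_pi, Real.sin_add_int_mul_two_pi, Real.cos_add, Real.sin_add,
      Complex.cos_arg hz0, Complex.sin_arg, hnorm, ht]
    rw [ht] at hpos
    refine Plane.ext' ?_ ?_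
    · simp only [hz, PiLp.smul_apply, PiLp.sub_apply, smul_eq_mul]
      simp only [Matrix.cons_val_zero]
      field_simp
      linear_combination (-(γ (L * u) 0 - x 0)) * hsc
    · simp only [hz, PiLp.smul_apply, PiLp.sub_apply, smul_eq_mul]
      simp only [Matrix.cons_val_one, Matrix.cons_val_fin_one]
      field_simp
      linear_combination (-(γ (L * u) 1 - x 1)) * hsc
  · have h1 : L / L = ((1 : ℤ) : ℝ) := by simp [hL.ne']
    simp only [h1, Int.fract_intCast, zero_div, Int.fract_zero]
    simp

/-- The hypothesis says that the curve misses the ray from x in the direction φ + π; the constant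
angle φ then serves as the rough angle. -/
theorem hasDegree_zero_of_ray {γ : ℝ → Plane} {L : ℝ} (hL : 0 < L) (hγ : Continuous γ)
    (hper : Function.Periodic γ L) {x : Plane} (φ : ℝ)
    (h : ∀ t, 0 < (γ t 0 - x 0) * Real.cos φ + (γ t 1 - x 1) * Real.sin φ ∨
        (γ t 1 - x 1) * Real.cos φ - (γ t 0 - x 0) * Real.sin φ ≠ 0) :
    HasDegree (fun t => ‖γ t - x‖⁻¹ • (γ t - x)) L 0 :=
  hasDegree_of_ne_opposite hL hγ hper (ψ := fun _ => φ) continuous_const (by simp)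
    fun t _ => h t

/-- If a closed line separates `x` from the curve, then the degree is zero. -/
theorem hasDegree_zero_of_halfPlane {γ : ℝ → Plane} {L : ℝ} (hL : 0 < L) (hγ : Continuous γ)
    (hper : Function.Periodic γ L) {x : Plane} (u v : ℝ)
    (h : ∀ t, 0 < (γ t 0 - x 0) * u + (γ t 1 - x 1) * v) :
    HasDegree (fun t => ‖γ t - x‖⁻¹ • (γ t - x)) L 0 := by
  set w : ℂ := ⟨u, v⟩ with hw
  have hw0 : w ≠ 0 := by
    intro h0
    have hu : u = 0 := congrArg Complex.re h0
    have hv : v = 0 := congrArg Complex.im h0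
    simpa [hu, hv] using h 0
  have hn : 0 < ‖w‖ := norm_pos_iff.2 hw0
  refine hasDegree_zero_of_ray hL hγ hper w.arg fun t => Or.inl ?_
  rw [Complex.cos_arg hw0, Complex.sin_arg]
  rw [mul_div_assoc', mul_div_assoc', ← add_div]
  exact div_pos (h t) hn

/-- The degree does not change if `x` moves by less than its distance to the curve. -/
theorem HasDegree.of_norm_sub_lt {γ : ℝ → Plane} {L : ℝ} (hL : 0 < L) (hγ : Continuous γ)
    (hper : Function.Periodic γ L) {x y : Plane} {k : ℤ}
    (hx : HasDegree (fun t => ‖γ t - x‖⁻¹ • (γ t - x)) L k)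
    (hxy : ∀ t, ‖x - y‖ < ‖γ t - x‖) :
    HasDegree (fun t => ‖γ t - y‖⁻¹ • (γ t - y)) L k := by
  obtain ⟨θ, hθ, hr, hk⟩ := hx
  refine hasDegree_of_ne_opposite hL hγ hper hθ hk fun t _ => Or.inl ?_
  have hpos : 0 < ‖γ t - x‖ := (norm_nonneg _).trans_lt (hxy t)
  have h0 : γ t 0 - x 0 = ‖γ t - x‖ * Real.cos (θ t) := by
    have : ‖γ t - x‖⁻¹ * (γ t 0 - x 0) = Real.cos (θ t) :=
      congrArg (fun v : Plane => v 0) (hr t)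
    rw [← this]; field_simp
  have h1 : γ t 1 - x 1 = ‖γ t - x‖ * Real.sin (θ t) := by
    have : ‖γ t - x‖⁻¹ * (γ t 1 - x 1) = Real.sin (θ t) :=
      congrArg (fun v : Plane => v 1) (hr t)
    rw [← this]; field_simp
  have hsc := Real.sin_sq_add_cos_sq (θ t)
  have h2 : -((x 0 - y 0) * Real.cos (θ t) + (x 1 - y 1) * Real.sin (θ t)) ≤ ‖x - y‖ := by
    refine le_of_sq_le_sq ?_ (norm_nonneg _)
    rw [Plane.norm_sq]
    simp only [PiLp.sub_apply]
    nlinarith [sq_nonneg ((x 0 - y 0) * Real.sin (θ t) - (x 1 - y 1) * Real.cos (θ t))]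
  have h3 := hxy t
  have h4 : (γ t 0 - y 0) * Real.cos (θ t) + (γ t 1 - y 1) * Real.sin (θ t) =
      ‖γ t - x‖ + ((x 0 - y 0) * Real.cos (θ t) + (x 1 - y 1) * Real.sin (θ t)) := by
    linear_combination Real.cos (θ t) * h0 + Real.sin (θ t) * h1 + ‖γ t - x‖ * hsc
  linarith

/-- The degree is constant on connected sets off the curve. -/
theorem HasDegree.of_isPreconnected {γ : ℝ → Plane} {L : ℝ} (hL : 0 < L) (hγ : Continuous γ)
    (hper : Function.Periodic γ L) {S : Set Plane} (hS : IsPreconnected S)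
    (hSγ : Disjoint S (Set.range γ)) {x y : Plane} (hxS : x ∈ S) (hyS : y ∈ S) {k : ℤ}
    (hx : HasDegree (fun t => ‖γ t - x‖⁻¹ • (γ t - x)) L k) :
    HasDegree (fun t => ‖γ t - y‖⁻¹ • (γ t - y)) L k := by
  have hclosed : IsClosed (Set.range γ) := by
    rw [← hper.image_Icc hL 0]
    exact (isCompact_Icc.image hγ).isClosed
  -- Halving the distance to the curve makes `of_norm_sub_lt` usable from a to b and from b to a, so
  -- that having degree k and not having degree k are both open conditions off the curve.
  have hball : ∀ a, a ∉ Set.range γ → ∃ δ > 0, ∀ b, ‖b - a‖ < δ → b ∉ Set.range γ ∧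
      ((∀ t, ‖a - b‖ < ‖γ t - a‖) ∧ ∀ t, ‖b - a‖ < ‖γ t - b‖) := by
    intro a ha
    obtain ⟨δ, hδ, hb⟩ := Metric.isOpen_iff.1 hclosed.isOpen_compl a ha
    have hfar : ∀ t, δ ≤ ‖γ t - a‖ := by
      intro t
      by_contra! hlt
      exact hb (by rwa [Metric.mem_ball, dist_eq_norm]) ⟨t, rfl⟩
    refine ⟨δ / 2, half_pos hδ, fun b hb' => ⟨hb ?_, fun t => ?_, fun t => ?_⟩⟩
    · rw [Metric.mem_ball, dist_eq_norm]; linarith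
    · rw [norm_sub_rev]; linarith [hfar t]
    · have := norm_sub_le_norm_sub_add_norm_sub (γ t) b a
      linarith [hfar t]
  set P : Plane → Prop := fun a => HasDegree (fun t => ‖γ t - a‖⁻¹ • (γ t - a)) L k with hP
  have hU : IsOpen {a | a ∉ Set.range γ ∧ P a} := by
    refine Metric.isOpen_iff.2 fun a ha => ?_
    obtain ⟨δ, hδ, hb⟩ := hball a ha.1
    refine ⟨δ, hδ, fun b hb' => ?_⟩
    rw [Metric.mem_ball, dist_eq_norm] at hb'
    exact ⟨(hb b hb').1, ha.2.of_norm_sub_lt hL hγ hper (hb b hb').2.1⟩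
  have hV : IsOpen {a | a ∉ Set.range γ ∧ ¬P a} := by
    refine Metric.isOpen_iff.2 fun a ha => ?_
    obtain ⟨δ, hδ, hb⟩ := hball a ha.1
    refine ⟨δ, hδ, fun b hb' => ?_⟩
    rw [Metric.mem_ball, dist_eq_norm] at hb'
    exact ⟨(hb b hb').1, fun hPb => ha.2 (HasDegree.of_norm_sub_lt hL hγ hper hPb (hb b hb').2.2)⟩
  have hoff : ∀ a ∈ S, a ∉ Set.range γ := fun a ha => Set.disjoint_left.1 hSγ ha
  have := hS.subset_left_of_subset_union hU hV
    (Set.disjoint_left.2 fun a ha ha' => ha'.2 ha.2)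
    (fun a ha => (em (P a)).imp (fun h => ⟨hoff a ha, h⟩) fun h => ⟨hoff a ha, h⟩)
    ⟨x, hxS, hoff x hxS, hx⟩
  exact (this hyS).2

theorem windingMod2_eq_one {γ : ℝ → Plane} {L : ℝ} {x : Plane} {k : ℤ}
    (h : HasDegree (fun t => ‖γ t - x‖⁻¹ • (γ t - x)) L k) (hk : Odd k) :
    windingMod2 γ L x = 1 :=
  if_pos ⟨k, h, hk⟩

theorem windingMod2_eq_zero {γ : ℝ → Plane} {L : ℝ} {x : Plane} {k : ℤ}
    (h : HasDegree (fun t => ‖γ t - x‖⁻¹ • (γ t - x)) L k) (hk : Even k) :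
    windingMod2 γ L x = 0 := by
  refine if_neg ?_
  rintro ⟨l, hl, hodd⟩
  rw [hl.unique h] at hodd
  exact Int.not_odd_iff_even.2 hk hodd

theorem windingMod2_eq_zero_of_mem_range {γ : ℝ → Plane} {L : ℝ} {x : Plane}
    (hx : x ∈ Set.range γ) : windingMod2 γ L x = 0 := by
  refine if_neg ?_
  rintro ⟨l, ⟨θ, -, hr, -⟩, -⟩
  obtain ⟨t, rfl⟩ := hx
  have h : ‖γ t - γ t‖⁻¹ • (γ t - γ t) = _ := hr t
  rw [sub_self, smul_zero] at h
  have h0 : 0 = Real.cos (θ t) := congrArg (fun v : Plane => v 0) h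
  have h1 : 0 = Real.sin (θ t) := congrArg (fun v : Plane => v 1) h
  have := Real.sin_sq_add_cos_sq (θ t)
  rw [← h0, ← h1] at this
  norm_num at this

/-! ### Reflection, polar coordinates, unit speed lines and arcs. -/

/-- The reflection of the plane in the first coordinate axis. -/
def Plane.reflect : Plane →ₗᵢ[ℝ] Plane where
  toFun x := !₂[x 0, -x 1]
  map_add' x y := Plane.ext' rfl (neg_add _ _)
  map_smul' c x := Plane.ext' rfl (mul_neg _ _).symm
  norm_map' x := by
    refine (sq_eq_sq₀ (norm_nonneg _) (norm_nonneg _)).1 ?_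
    rw [Plane.norm_sq, Plane.norm_sq]
    change x 0 ^ 2 + (-x 1) ^ 2 = _
    ring

@[simp] theorem Plane.reflect_zero (x : Plane) : Plane.reflect x 0 = x 0 := rfl

@[simp] theorem Plane.reflect_one (x : Plane) : Plane.reflect x 1 = -x 1 := rfl

@[simp] theorem Plane.reflect_reflect (x : Plane) : Plane.reflect (Plane.reflect x) = x :=
  Plane.ext' (by simp) (by simp)

theorem Plane.reflect_eq_self {x : Plane} (h : x 1 = 0) : Plane.reflect x = x :=
  Plane.ext' (by simp) (by simp [h])

theorem Plane.norm_eq_one {u v : ℝ} (h : u ^ 2 + v ^ 2 = 1) : ‖(!₂[u, v] : Plane)‖ = 1 := by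
  refine (sq_eq_sq₀ (norm_nonneg _) zero_le_one).1 ?_
  rw [Plane.norm_sq, one_pow, ← h]
  rfl

theorem Plane.hasDerivAt {f g : ℝ → ℝ} {f' g' t : ℝ} (hf : HasDerivAt f f' t)
    (hg : HasDerivAt g g' t) :
    HasDerivAt (fun t => (!₂[f t, g t] : Plane)) !₂[f', g'] t := by
  have hdec : ∀ u v : ℝ, (!₂[u, v] : Plane) = u • !₂[1, 0] + v • !₂[0, 1] := fun u v =>
    Plane.ext' (by simp) (by simp)
  rw [funext fun t => hdec (f t) (g t), hdec f' g']
  exact (hf.smul_const _).add (hg.smul_const _)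

/-- Polar coordinates in the right half-plane. -/
theorem Plane.exists_angle {x : Plane} {ρ : ℝ} (hρ : 0 < ρ) (hx0 : 0 ≤ x 0)
    (hsq : x 0 ^ 2 + x 1 ^ 2 = ρ ^ 2) :
    ∃ θ, -(Real.pi / 2) ≤ θ ∧ θ ≤ Real.pi / 2 ∧ (0 ≤ x 1 → 0 ≤ θ) ∧
      x 0 = ρ * Real.cos θ ∧ x 1 = ρ * Real.sin θ := by
  have habs := abs_le_of_sq_le_sq' (show x 1 ^ 2 ≤ ρ ^ 2 by nlinarith) hρ.le
  have hle : x 1 / ρ ≤ 1 := by rw [div_le_one hρ]; exact habs.2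
  have hge : -1 ≤ x 1 / ρ := by rw [le_div_iff₀ hρ]; linarith [habs.1]
  refine ⟨Real.arcsin (x 1 / ρ), Real.neg_pi_div_two_le_arcsin _, Real.arcsin_le_pi_div_two _,
    fun h => Real.arcsin_nonneg.2 (by positivity), ?_, ?_⟩
  · have : 1 - (x 1 / ρ) ^ 2 = (x 0 / ρ) ^ 2 := by field_simp; linarith
    rw [Real.cos_arcsin, this, Real.sqrt_sq (by positivity)]; field_simp
  · rw [Real.sin_arcsin hge hle]; field_simp

theorem hasUnitOneSidedDerivs_line {f g : ℝ → ℝ} (p q u v : ℝ) (h : u ^ 2 + v ^ 2 = 1)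
    (hf : ∀ t, f t = p + u * t) (hg : ∀ t, g t = q + v * t) :
    HasUnitOneSidedDerivs fun t : ℝ => (!₂[f t, g t] : Plane) := by
  rw [funext hf, funext hg]
  exact .of_hasDerivAt (fun t => Plane.hasDerivAt
    (by simpa using ((hasDerivAt_id t).const_mul u).const_add p)
    (by simpa using ((hasDerivAt_id t).const_mul v).const_add q)) fun _ => Plane.norm_eq_one h

theorem hasUnitOneSidedDerivs_arc {ρ : ℝ} (h : 0 < ρ) :
    HasUnitOneSidedDerivs fun t : ℝ =>
      (!₂[ρ * Real.cos (t / ρ), ρ * Real.sin (t / ρ)] : Plane) := by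
  have hd : ∀ t, HasDerivAt (fun t : ℝ => t / ρ) (1 / ρ) t := fun t =>
    (hasDerivAt_id t).div_const ρ
  refine .of_hasDerivAt (f' := fun t => !₂[-Real.sin (t / ρ), Real.cos (t / ρ)])
    (fun t => Plane.hasDerivAt ?_ ?_) fun t => Plane.norm_eq_one ?_
  · exact ((hd t).cos.const_mul ρ).congr_deriv (by field_simp)
  · exact ((hd t).sin.const_mul ρ).congr_deriv (by field_simp)
  · rw [neg_sq, Real.sin_sq_add_cos_sq]

/-! ### The upper half of the outline. -/

namespace Horseshoe

/-- The relations between the radii and the gap of a horseshoe. -/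
structure IsShape (R h r : ℝ) : Prop where
  gap_pos : 0 < h
  gap_lt : h < r
  lt : r < R
  -- Equivalent to πR/2 = (r - h) + πr/2: the balance between outer and inner lengths that makes
  -- antipodal chords short.
  eq : (Real.pi + 2) * r = Real.pi * R + 2 * h

/-- Half of the length of the outline. -/
noncomputable def halfLength (R h : ℝ) : ℝ := Real.pi * R + 2 + (R - h)

/-- The upper half of the outline, parametrized by arc length on `[0, halfLength R h]`, from the
rightmost point of the large semicircle to that of the small one. -/
noncomputable def upperHalf (R h r t : ℝ) : Plane :=
  if t < Real.pi * R / 2 then !₂[R * Real.cos (t / R), R * Real.sin (t / R)]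
  else if t < Real.pi * R / 2 + 1 then !₂[Real.pi * R / 2 - t, R]
  else if t < halfLength R h - (Real.pi * R / 2 + 1) then !₂[-1, R + (Real.pi * R / 2 + 1) - t]
  else if t < halfLength R h - Real.pi * R / 2 then !₂[t - (halfLength R h - Real.pi * R / 2), h]
  else if t < halfLength R h - Real.pi * r / 2 then
    !₂[0, h + (t - (halfLength R h - Real.pi * R / 2))]
  else !₂[r * Real.cos ((halfLength R h - t) / r), r * Real.sin ((halfLength R h - t) / r)]

/-- The outline, parametrized by arc length on `[0, 2 * halfLength R h]`. -/
noncomputable def closedCurve (R h r t : ℝ) : Plane :=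
  if t < halfLength R h then upperHalf R h r t
  else Plane.reflect (upperHalf R h r (2 * halfLength R h - t))

/-- The periodic parametrization of the outline by arc length. -/
noncomputable def curve (R h r t : ℝ) : Plane :=
  closedCurve R h r (2 * halfLength R h * Int.fract (t / (2 * halfLength R h)))

/-- The outline in coordinates. -/
def IsOnOutline (R h r : ℝ) (x : Plane) : Prop :=
  (-1 ≤ x 0 ∧ x 0 ≤ 0 ∧ |x 1| = R) ∨ (0 ≤ x 0 ∧ x 0 ^ 2 + x 1 ^ 2 = R ^ 2) ∨
  (x 0 = -1 ∧ h ≤ |x 1| ∧ |x 1| ≤ R) ∨ (-1 ≤ x 0 ∧ x 0 ≤ 0 ∧ |x 1| = h) ∨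
  (x 0 = 0 ∧ h ≤ |x 1| ∧ |x 1| ≤ r) ∨ (0 ≤ x 0 ∧ x 0 ^ 2 + x 1 ^ 2 = r ^ 2)

namespace IsShape

variable {R h r : ℝ} (H : IsShape R h r)
include H

theorem small_pos : 0 < r := H.gap_pos.trans H.gap_lt

theorem big_pos : 0 < R := H.small_pos.trans H.lt

theorem gap_lt_big : h < R := H.gap_lt.trans H.lt

/-- Orders the break times of `upperHalf`. The third conjunct encodes the length balance: the last
straight piece has length r - h and ends where the small arc begins. -/
theorem breaks : 0 < Real.pi * R / 2 ∧
    Real.pi * R / 2 + 1 < halfLength R h - (Real.pi * R / 2 + 1) ∧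
    halfLength R h - Real.pi * r / 2 = halfLength R h - Real.pi * R / 2 + (r - h) ∧
    0 < Real.pi * r / 2 ∧ 0 < halfLength R h := by
  have h1 := mul_pos Real.pi_pos H.big_pos
  have h2 := mul_pos Real.pi_pos H.small_pos
  have h3 := H.gap_lt_big
  have h4 := H.eq
  unfold halfLength
  refine ⟨?_, ?_, ?_, ?_, ?_⟩ <;> linarith

theorem halfLength_pos : 0 < halfLength R h := H.breaks.2.2.2.2

theorem hasUnitOneSidedDerivs_upperHalf : HasUnitOneSidedDerivs (upperHalf R h r) := by
  obtain ⟨h1, h2, h3, h4, -⟩ := H.breaks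
  have hR := H.big_pos.ne'
  have hr := H.small_pos.ne'
  have hgap := H.gap_lt
  have hhalf : halfLength R h = Real.pi * R + 2 + (R - h) := rfl
  have e1 := hasUnitOneSidedDerivs_arc H.big_pos
  have e2 : HasUnitOneSidedDerivs fun t => (!₂[Real.pi * R / 2 - t, R] : Plane) :=
    hasUnitOneSidedDerivs_line (Real.pi * R / 2) (R) (-1) 0 (by norm_num) (fun t => by ring)
      fun t => by ring
  have e3 : HasUnitOneSidedDerivs fun t => (!₂[-1, R + (Real.pi * R / 2 + 1) - t] : Plane) :=
    hasUnitOneSidedDerivs_line (-1) (R + (Real.pi * R / 2 + 1)) 0 (-1) (by norm_num) (fun t => by ring)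
      fun t => by ring
  have e4 : HasUnitOneSidedDerivs fun t =>
      (!₂[t - (halfLength R h - Real.pi * R / 2), h] : Plane) :=
    hasUnitOneSidedDerivs_line (-(halfLength R h - Real.pi * R / 2)) (h) 1 0 (by norm_num) (fun t => by ring)
      fun t => by ring
  have e5 : HasUnitOneSidedDerivs fun t =>
      (!₂[0, h + (t - (halfLength R h - Real.pi * R / 2))] : Plane) :=
    hasUnitOneSidedDerivs_line (0) (h - (halfLength R h - Real.pi * R / 2)) 0 1 (by norm_num) (fun t => by ring)
      fun t => by ring
  have e6 := (hasUnitOneSidedDerivs_arc H.small_pos).comp_const_sub (halfLength R h)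
  refine e1.ite_lt (e2.ite_lt (e3.ite_lt (e4.ite_lt (e5.ite_lt e6 ?_) ?_) ?_) ?_) ?_
  · have : (halfLength R h - (halfLength R h - Real.pi * r / 2)) / r = Real.pi / 2 := by
      field_simp; ring
    rw [this, Real.cos_pi_div_two, Real.sin_pi_div_two, h3]
    refine Plane.ext' ?_ ?_ <;> simp
  · rw [if_pos (by linarith)]
    refine Plane.ext' ?_ ?_ <;> simp
  · rw [if_pos (by linarith)]
    refine Plane.ext' ?_ ?_ <;> simp
    linarith
  · rw [if_pos (by linarith)]
    refine Plane.ext' ?_ ?_ <;> simp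
  · rw [if_pos (by linarith)]
    have : Real.pi * R / 2 / R = Real.pi / 2 := by field_simp
    rw [this, Real.cos_pi_div_two, Real.sin_pi_div_two]
    refine Plane.ext' ?_ ?_ <;> simp

theorem upperHalf_zero : upperHalf R h r 0 = !₂[R, 0] := by
  rw [upperHalf, if_pos H.breaks.1]
  simp

theorem upperHalf_halfLength : upperHalf R h r (halfLength R h) = !₂[r, 0] := by
  obtain ⟨h1, h2, h3, h4, -⟩ := H.breaks
  have hgap := H.gap_lt
  rw [upperHalf, if_neg (by linarith), if_neg (by linarith), if_neg (by linarith),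
    if_neg (by linarith), if_neg (by linarith)]
  simp

/-- The pieces of the upper half. -/
theorem upperHalf_cases {t : ℝ} (h0 : 0 ≤ t) (hM : t ≤ halfLength R h) :
    (∃ θ, 0 ≤ θ ∧ θ < Real.pi / 2 ∧ t = R * θ ∧
      upperHalf R h r t = !₂[R * Real.cos θ, R * Real.sin θ]) ∨
    (∃ s, 0 ≤ s ∧ s < 1 ∧ t = Real.pi * R / 2 + s ∧ upperHalf R h r t = !₂[-s, R]) ∨
    (∃ s, h < s ∧ s ≤ R ∧ t = Real.pi * R / 2 + 1 + (R - s) ∧ upperHalf R h r t = !₂[-1, s]) ∨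
    (∃ s, 0 < s ∧ s ≤ 1 ∧ t = halfLength R h - Real.pi * R / 2 - s ∧
      upperHalf R h r t = !₂[-s, h]) ∨
    (∃ s, h ≤ s ∧ s < r ∧ t = halfLength R h - Real.pi * R / 2 + (s - h) ∧
      upperHalf R h r t = !₂[0, s]) ∨
    (∃ θ, 0 ≤ θ ∧ θ ≤ Real.pi / 2 ∧ t = halfLength R h - r * θ ∧
      upperHalf R h r t = !₂[r * Real.cos θ, r * Real.sin θ]) := by
  obtain ⟨h1, h2, h3, h4, -⟩ := H.breaks
  have hR := H.big_pos
  have hr := H.small_pos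
  have hhalf : halfLength R h = Real.pi * R + 2 + (R - h) := rfl
  unfold upperHalf
  split_ifs with c1 c2 c3 c4 c5
  · refine Or.inl ⟨t / R, by positivity, ?_, by field_simp, rfl⟩
    rw [div_lt_iff₀ hR]; linarith
  · refine Or.inr (Or.inl ⟨t - Real.pi * R / 2, by linarith, by linarith, by ring, ?_⟩)
    rw [neg_sub]
  · exact Or.inr (Or.inr (Or.inl ⟨R + (Real.pi * R / 2 + 1) - t, by linarith, by linarith,
      by ring, rfl⟩))
  · refine Or.inr (Or.inr (Or.inr (Or.inl ⟨halfLength R h - Real.pi * R / 2 - t, by linarith,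
      by linarith, by ring, ?_⟩)))
    rw [neg_sub]
  · exact Or.inr (Or.inr (Or.inr (Or.inr (Or.inl ⟨h + (t - (halfLength R h - Real.pi * R / 2)),
      by linarith, by linarith, by ring, rfl⟩))))
  · refine Or.inr (Or.inr (Or.inr (Or.inr (Or.inr ⟨(halfLength R h - t) / r, ?_, ?_, ?_, rfl⟩))))
    · exact div_nonneg (by linarith) hr.le
    · rw [div_le_iff₀ hr]; linarith
    · field_simp; ring

theorem upperHalf_injOn : Set.InjOn (upperHalf R h r) (Set.Icc 0 (halfLength R h)) := by
  have hR := H.big_pos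
  have hr := H.small_pos
  have hh := H.gap_pos
  have hhr := H.gap_lt
  have hrR := H.lt
  -- The left inverse recovers the time from the point. A corner belongs to two pieces and may be
  -- decoded by the branch of its neighbour, hence the extra case splits below.
  refine Set.LeftInvOn.injOn (f₁' := fun x : Plane =>
    if 0 < x 0 then
      if r ^ 2 < x 0 ^ 2 + x 1 ^ 2 then R * Real.arcsin (x 1 / R)
      else halfLength R h - r * Real.arcsin (x 1 / r)
    else if x 1 = R then Real.pi * R / 2 - x 0
    else if x 0 = -1 then Real.pi * R / 2 + 1 + (R - x 1)
    else if x 1 = h then halfLength R h - Real.pi * R / 2 + x 0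
    else halfLength R h - Real.pi * R / 2 + (x 1 - h)) fun t ht => ?_
  have hpi := Real.pi_pos
  rcases H.upperHalf_cases ht.1 ht.2 with ⟨θ, h1, h2, h3, h4⟩ | ⟨s, h1, h2, h3, h4⟩ |
    ⟨s, h1, h2, h3, h4⟩ | ⟨s, h1, h2, h3, h4⟩ | ⟨s, h1, h2, h3, h4⟩ | ⟨θ, h1, h2, h3, h4⟩ <;>
  rw [h4] <;> simp only [Matrix.cons_val_zero, Matrix.cons_val_one, Matrix.cons_val_fin_one]
  · have hc : 0 < Real.cos θ := Real.cos_pos_of_mem_Ioo ⟨by linarith, h2⟩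
    rw [if_pos (mul_pos hR hc), if_pos, mul_div_cancel_left₀ _ hR.ne',
      Real.arcsin_sin (by linarith) h2.le, h3]
    have : (R * Real.cos θ) ^ 2 + (R * Real.sin θ) ^ 2 = R ^ 2 := by
      linear_combination R ^ 2 * Real.sin_sq_add_cos_sq θ
    rw [this]
    exact pow_lt_pow_left₀ hrR hr.le two_ne_zero
  · rw [if_neg (by linarith), if_pos trivial, h3]; ring
  · rcases h2.lt_or_eq with h5 | h5
    · rw [if_neg (by norm_num), if_neg h5.ne, if_pos trivial, h3]
    · rw [if_neg (by norm_num), if_pos h5, h3, h5]; ring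
  · rw [if_neg (by linarith), if_neg (by linarith)]
    split_ifs with h5
    · rw [h3, show s = 1 by linarith, halfLength]; ring
    · rw [h3]; ring
  · rw [if_neg (by norm_num), if_neg (by linarith), if_neg (by norm_num)]
    split_ifs with h5
    · rw [h3, h5]; ring
    · rw [h3]
  · rcases h2.lt_or_eq with h5 | h5
    · have hc : 0 < Real.cos θ := Real.cos_pos_of_mem_Ioo ⟨by linarith, h5⟩
      have : (r * Real.cos θ) ^ 2 + (r * Real.sin θ) ^ 2 = r ^ 2 := by
        linear_combination r ^ 2 * Real.sin_sq_add_cos_sq θ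
      rw [if_pos (mul_pos hr hc), if_neg this.not_gt, mul_div_cancel_left₀ _ hr.ne',
        Real.arcsin_sin (by linarith) h2, h3]
    · rw [h5, Real.cos_pi_div_two, Real.sin_pi_div_two, mul_zero, mul_one, if_neg (lt_irrefl _),
        if_neg hrR.ne, if_neg (by norm_num), if_neg hhr.ne', h3, h5]
      linarith [H.eq]

theorem upperHalf_one_nonneg {t : ℝ} (h0 : 0 ≤ t) (hM : t ≤ halfLength R h) :
    0 ≤ upperHalf R h r t 1 := by
  have hR := H.big_pos
  have hr := H.small_pos
  have hh := H.gap_pos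
  have hpi := Real.pi_pos
  rcases H.upperHalf_cases h0 hM with ⟨θ, h1, h2, h3, h4⟩ | ⟨s, h1, h2, h3, h4⟩ |
    ⟨s, h1, h2, h3, h4⟩ | ⟨s, h1, h2, h3, h4⟩ | ⟨s, h1, h2, h3, h4⟩ | ⟨θ, h1, h2, h3, h4⟩ <;>
  rw [h4] <;> simp only [Matrix.cons_val_one, Matrix.cons_val_fin_one]
  · exact mul_nonneg hR.le (Real.sin_nonneg_of_nonneg_of_le_pi h1 (by linarith))
  · linarith
  · linarith
  · linarith
  · linarith
  · exact mul_nonneg hr.le (Real.sin_nonneg_of_nonneg_of_le_pi h1 (by linarith))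

theorem eq_zero_or_eq_of_upperHalf_one_eq_zero {t : ℝ} (h0 : 0 ≤ t) (hM : t ≤ halfLength R h)
    (ht : upperHalf R h r t 1 = 0) : t = 0 ∨ t = halfLength R h := by
  have hR := H.big_pos
  have hr := H.small_pos
  have hh := H.gap_pos
  have hpi := Real.pi_pos
  rcases H.upperHalf_cases h0 hM with ⟨θ, h1, h2, h3, h4⟩ | ⟨s, h1, h2, h3, h4⟩ |
    ⟨s, h1, h2, h3, h4⟩ | ⟨s, h1, h2, h3, h4⟩ | ⟨s, h1, h2, h3, h4⟩ | ⟨θ, h1, h2, h3, h4⟩ <;>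
  rw [h4] at ht <;> simp only [Matrix.cons_val_one, Matrix.cons_val_fin_one] at ht
  · rcases h1.lt_or_eq with h5 | h5
    · exact absurd ht (mul_pos hR (Real.sin_pos_of_pos_of_lt_pi h5 (by linarith))).ne'
    · left; rw [h3, ← h5, mul_zero]
  · linarith
  · linarith
  · linarith
  · linarith
  · rcases h1.lt_or_eq with h5 | h5
    · exact absurd ht (mul_pos hr (Real.sin_pos_of_pos_of_lt_pi h5 (by linarith))).ne'
    · right; rw [h3, ← h5, mul_zero, sub_zero]

theorem isOnOutline_upperHalf {t : ℝ} (h0 : 0 ≤ t) (hM : t ≤ halfLength R h) :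
    IsOnOutline R h r (upperHalf R h r t) := by
  have hR := H.big_pos
  have hr := H.small_pos
  have hh := H.gap_pos
  have hpi := Real.pi_pos
  unfold IsOnOutline
  rcases H.upperHalf_cases h0 hM with ⟨θ, h1, h2, h3, h4⟩ | ⟨s, h1, h2, h3, h4⟩ |
    ⟨s, h1, h2, h3, h4⟩ | ⟨s, h1, h2, h3, h4⟩ | ⟨s, h1, h2, h3, h4⟩ | ⟨θ, h1, h2, h3, h4⟩ <;>
  rw [h4] <;> simp only [Matrix.cons_val_zero, Matrix.cons_val_one, Matrix.cons_val_fin_one]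
  · refine Or.inr (Or.inl ⟨mul_nonneg hR.le (Real.cos_nonneg_of_neg_pi_div_two_le_of_le
      (by linarith) h2.le), ?_⟩)
    linear_combination R ^ 2 * Real.sin_sq_add_cos_sq θ
  · exact Or.inl ⟨by linarith, by linarith, abs_of_pos hR⟩
  · have hs : |s| = s := abs_of_pos (by linarith)
    exact Or.inr (Or.inr (Or.inl ⟨trivial, by linarith, by linarith⟩))
  · exact Or.inr (Or.inr (Or.inr (Or.inl ⟨by linarith, by linarith, abs_of_pos hh⟩)))
  · have hs : |s| = s := abs_of_pos (by linarith)
    exact Or.inr (Or.inr (Or.inr (Or.inr (Or.inl ⟨trivial, by linarith, by linarith⟩))))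
  · refine Or.inr (Or.inr (Or.inr (Or.inr (Or.inr ⟨mul_nonneg hr.le
      (Real.cos_nonneg_of_neg_pi_div_two_le_of_le (by linarith) h2), ?_⟩))))
    linear_combination r ^ 2 * Real.sin_sq_add_cos_sq θ

theorem exists_upperHalf_eq {x : Plane} (hx : IsOnOutline R h r x) (hx1 : 0 ≤ x 1) :
    ∃ t, 0 ≤ t ∧ t ≤ halfLength R h ∧ upperHalf R h r t = x := by
  obtain ⟨b1, b2, b3, b4, -⟩ := H.breaks
  have hR := H.big_pos
  have hr := H.small_pos
  have hh := H.gap_pos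
  have hhr := H.gap_lt
  have hrR := H.lt
  have hhalf : halfLength R h = Real.pi * R + 2 + (R - h) := rfl
  unfold IsOnOutline at hx
  rw [abs_of_nonneg hx1] at hx
  rcases hx with ⟨h1, h2, h3⟩ | ⟨h1, h2⟩ | ⟨h1, h2, h3⟩ | ⟨h1, h2, h3⟩ | ⟨h1, h2, h3⟩ | ⟨h1, h2⟩
  · refine ⟨Real.pi * R / 2 - x 0, by linarith, by linarith, ?_⟩
    rw [upperHalf, if_neg (by linarith)]
    rcases h1.lt_or_eq with h4 | h4
    · rw [if_pos (by linarith)]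
      exact Plane.ext' (by simp) (by simp [h3])
    · rw [if_neg (by linarith), if_pos (by linarith)]
      exact Plane.ext' (by simp [← h4]) (by simp [← h4, h3])
  · obtain ⟨θ, -, t2, t1, t3, t4⟩ := Plane.exists_angle hR h1 h2
    replace t1 := t1 hx1
    refine ⟨R * θ, by positivity, by nlinarith, ?_⟩
    rcases t2.lt_or_eq with t5 | t5
    · rw [upperHalf, if_pos (by nlinarith), mul_div_cancel_left₀ _ hR.ne']
      exact Plane.ext' t3.symm t4.symm
    · rw [t5, Real.cos_pi_div_two] at t3
      rw [t5, Real.sin_pi_div_two] at t4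
      rw [t5, upperHalf, if_neg (by linarith), if_pos (by linarith)]
      refine Plane.ext' ?_ ?_ <;> simp [t3, t4]
      ring
  · refine ⟨Real.pi * R / 2 + 1 + (R - x 1), by linarith, by linarith, ?_⟩
    rw [upperHalf, if_neg (by linarith), if_neg (by linarith)]
    rcases h2.lt_or_eq with h4 | h4
    · rw [if_pos (by linarith)]
      exact Plane.ext' (by simp [h1]) (by simp; ring)
    · rw [if_neg (by linarith), if_pos (by linarith)]
      refine Plane.ext' ?_ ?_ <;> simp <;> linarith
  · refine ⟨halfLength R h - Real.pi * R / 2 + x 0, by linarith, by linarith, ?_⟩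
    rw [upperHalf, if_neg (by linarith), if_neg (by linarith), if_neg (by linarith)]
    rcases h2.lt_or_eq with h4 | h4
    · rw [if_pos (by linarith)]
      refine Plane.ext' ?_ ?_ <;> simp [h3]
    · rw [if_neg (by linarith), if_pos (by linarith)]
      refine Plane.ext' ?_ ?_ <;> simp [h3, h4]
  · refine ⟨halfLength R h - Real.pi * R / 2 + (x 1 - h), by linarith, by linarith, ?_⟩
    rw [upperHalf, if_neg (by linarith), if_neg (by linarith), if_neg (by linarith),
      if_neg (by linarith)]
    rcases h3.lt_or_eq with h4 | h4
    · rw [if_pos (by linarith)]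
      refine Plane.ext' ?_ ?_ <;> simp [h1]
    · have : (halfLength R h - (halfLength R h - Real.pi * r / 2)) / r = Real.pi / 2 := by
        field_simp; ring
      rw [if_neg (by linarith), h4, ← b3, this, Real.cos_pi_div_two, Real.sin_pi_div_two]
      refine Plane.ext' ?_ ?_ <;> simp [h1, h4]
  · obtain ⟨θ, -, t2, t1, t3, t4⟩ := Plane.exists_angle hr h1 h2
    replace t1 := t1 hx1
    have t5 : r * θ ≤ Real.pi * r / 2 := by nlinarith
    refine ⟨halfLength R h - r * θ, by linarith, by linarith [mul_nonneg hr.le t1], ?_⟩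
    rw [upperHalf, if_neg (by linarith), if_neg (by linarith), if_neg (by linarith),
      if_neg (by linarith), if_neg (by linarith), sub_sub_cancel, mul_div_cancel_left₀ _ hr.ne']
    exact Plane.ext' t3.symm t4.symm

end IsShape

end Horseshoe

/-! ### The outline in coordinates and its closed parametrization. -/

theorem Plane.mem_segment_horizontal {a b c : ℝ} (hab : a < b) {x : Plane} :
    x ∈ segment ℝ (!₂[a, c] : Plane) !₂[b, c] ↔ a ≤ x 0 ∧ x 0 ≤ b ∧ x 1 = c := by
  rw [segment_eq_image]
  constructor
  · rintro ⟨θ, ⟨h0, h1⟩, rfl⟩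
    simp
    refine ⟨?_, ?_, ?_⟩ <;> nlinarith
  · rintro ⟨h0, h1, h2⟩
    have hpos : 0 < b - a := sub_pos.2 hab
    refine ⟨(x 0 - a) / (b - a), ⟨div_nonneg (by linarith) hpos.le, ?_⟩, Plane.ext' ?_ ?_⟩
    · rw [div_le_one hpos]; linarith
    · simp; field_simp; ring
    · simp [h2]; ring

theorem Plane.mem_segment_vertical {a b c : ℝ} (hab : a < b) {x : Plane} :
    x ∈ segment ℝ (!₂[c, a] : Plane) !₂[c, b] ↔ a ≤ x 1 ∧ x 1 ≤ b ∧ x 0 = c := by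
  rw [segment_eq_image]
  constructor
  · rintro ⟨θ, ⟨h0, h1⟩, rfl⟩
    simp
    refine ⟨?_, ?_, ?_⟩ <;> nlinarith
  · rintro ⟨h0, h1, h2⟩
    have hpos : 0 < b - a := sub_pos.2 hab
    refine ⟨(x 1 - a) / (b - a), ⟨div_nonneg (by linarith) hpos.le, ?_⟩, Plane.ext' ?_ ?_⟩
    · rw [div_le_one hpos]; linarith
    · simp [h2]; ring
    · simp; field_simp; ring

namespace Horseshoe

theorem mem_semicircle {ρ : ℝ} (hρ : 0 < ρ) {x : Plane} :
    x ∈ semicircle ρ ↔ 0 ≤ x 0 ∧ x 0 ^ 2 + x 1 ^ 2 = ρ ^ 2 := by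
  rw [← Plane.norm_sq, sq_eq_sq₀ (norm_nonneg _) hρ.le, and_comm]
  rfl

theorem isShape {n : ℕ} (hn : 1 ≤ n) : IsShape (bigRadius n) (halfGap n) (smallRadius n) := by
  have hn0 : (0 : ℝ) < n := by exact_mod_cast hn
  have hpi := Real.pi_pos
  have hgap : 0 < halfGap n := by unfold halfGap; positivity
  have hbig : bigRadius n = 1 / n + halfGap n := rfl
  have hinv : (0 : ℝ) < 1 / n := by positivity
  have hsmall : smallRadius n = (Real.pi * bigRadius n + 2 * halfGap n) / (Real.pi + 2) := by
    unfold smallRadius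
    congr 2
    unfold halfGap
    field_simp
  have hpos : 0 < Real.pi + 2 := by linarith
  refine ⟨hgap, ?_, ?_, ?_⟩
  · rw [hsmall, lt_div_iff₀ hpos, hbig]
    nlinarith [mul_pos hpi hinv]
  · rw [hsmall, div_lt_iff₀ hpos, hbig]
    nlinarith
  · rw [hsmall]; field_simp

theorem mem_outline_iff {n : ℕ} (hn : 1 ≤ n) {x : Plane} :
    x ∈ outline n ↔ IsOnOutline (bigRadius n) (halfGap n) (smallRadius n) x := by
  have H := isShape hn
  unfold outline IsOnOutline
  generalize bigRadius n = R at *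
  generalize halfGap n = h at *
  generalize smallRadius n = r at *
  have h1 := H.gap_pos
  have h2 := H.gap_lt
  have h3 := H.lt
  have h10 : (-1 : ℝ) < 0 := by norm_num
  simp only [Set.mem_union]
  rw [Plane.mem_segment_horizontal h10, segment_symm ℝ (!₂[0, -R] : Plane),
    Plane.mem_segment_horizontal h10, Plane.mem_segment_vertical (by linarith),
    Plane.mem_segment_horizontal h10, segment_symm ℝ (!₂[0, -h] : Plane),
    Plane.mem_segment_vertical (by linarith), segment_symm ℝ (!₂[0, r] : Plane),
    Plane.mem_segment_vertical (by linarith), segment_symm ℝ (!₂[0, h] : Plane),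
    Plane.mem_segment_horizontal h10, Plane.mem_segment_vertical (by linarith),
    mem_semicircle H.big_pos, mem_semicircle H.small_pos]
  have hR : |R| = R := abs_of_pos H.big_pos
  have hh : |h| = h := abs_of_pos h1
  constructor
  · rintro (((((((((⟨a, b, c⟩ | c) | ⟨a, b, c⟩) | ⟨a, b, c⟩) | ⟨a, b, c⟩) | ⟨a, b, c⟩) | c) |
      ⟨a, b, c⟩) | ⟨a, b, c⟩) | ⟨a, b, c⟩)
    · exact Or.inl ⟨a, b, by rw [c, hR]⟩
    · exact Or.inr (Or.inl c)
    · exact Or.inl ⟨a, b, by rw [c, abs_neg, hR]⟩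
    · have := abs_of_neg (show x 1 < 0 by linarith)
      exact Or.inr (Or.inr (Or.inl ⟨c, by linarith, by linarith⟩))
    · exact Or.inr (Or.inr (Or.inr (Or.inl ⟨a, b, by rw [c, abs_neg, hh]⟩)))
    · have := abs_of_neg (show x 1 < 0 by linarith)
      exact Or.inr (Or.inr (Or.inr (Or.inr (Or.inl ⟨c, by linarith, by linarith⟩))))
    · exact Or.inr (Or.inr (Or.inr (Or.inr (Or.inr c))))
    · have := abs_of_pos (show 0 < x 1 by linarith)
      exact Or.inr (Or.inr (Or.inr (Or.inr (Or.inl ⟨c, by linarith, by linarith⟩))))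
    · exact Or.inr (Or.inr (Or.inr (Or.inl ⟨a, b, by rw [c, hh]⟩)))
    · have := abs_of_pos (show 0 < x 1 by linarith)
      exact Or.inr (Or.inr (Or.inl ⟨c, by linarith, by linarith⟩))
  · rcases abs_cases (x 1) with ⟨ha, hs⟩ | ⟨ha, hs⟩ <;> rw [ha] <;>
      rintro (⟨a, b, c⟩ | c | ⟨a, b, c⟩ | ⟨a, b, c⟩ | ⟨a, b, c⟩ | c)
    · iterate 9 apply Or.inl
      exact ⟨a, b, c⟩
    · iterate 8 apply Or.inl
      exact Or.inr c
    · exact Or.inr ⟨b, c, a⟩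
    · exact Or.inl (Or.inr ⟨a, b, c⟩)
    · exact Or.inl (Or.inl (Or.inr ⟨b, c, a⟩))
    · exact Or.inl (Or.inl (Or.inl (Or.inr c)))
    · iterate 7 apply Or.inl
      exact Or.inr ⟨a, b, by linarith⟩
    · iterate 8 apply Or.inl
      exact Or.inr c
    · iterate 6 apply Or.inl
      exact Or.inr ⟨by linarith, by linarith, a⟩
    · iterate 5 apply Or.inl
      exact Or.inr ⟨a, b, by linarith⟩
    · iterate 4 apply Or.inl
      exact Or.inr ⟨by linarith, by linarith, a⟩
    · exact Or.inl (Or.inl (Or.inl (Or.inr c)))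

theorem isOnOutline_reflect {R h r : ℝ} {x : Plane} :
    IsOnOutline R h r (Plane.reflect x) ↔ IsOnOutline R h r x := by
  simp [IsOnOutline]

theorem curve_periodic (R h r : ℝ) (hM : 0 < halfLength R h) :
    Function.Periodic (curve R h r) (2 * halfLength R h) := by
  intro t
  have : (t + 2 * halfLength R h) / (2 * halfLength R h) =
      t / (2 * halfLength R h) + (1 : ℤ) := by
    push_cast; field_simp
  rw [curve, curve, this, Int.fract_add_intCast]

theorem curve_of_mem_Ico {R h r t : ℝ} (h0 : 0 ≤ t) (hM : t < 2 * halfLength R h) :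
    curve R h r t = closedCurve R h r t := by
  have hpos : 0 < 2 * halfLength R h := by linarith
  have : Int.fract (t / (2 * halfLength R h)) = t / (2 * halfLength R h) :=
    Int.fract_eq_self.2 ⟨by positivity, (div_lt_one hpos).2 hM⟩
  rw [curve, this, mul_div_cancel₀ _ hpos.ne']

namespace IsShape

variable {R h r : ℝ} (H : IsShape R h r)

include H

theorem curve_of_le {t : ℝ} (h0 : 0 ≤ t) (hM : t ≤ halfLength R h) :
    curve R h r t = upperHalf R h r t := by
  have hpos := H.halfLength_pos
  rw [curve_of_mem_Ico h0 (by linarith), closedCurve]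
  split_ifs with h1
  · rfl
  · have : t = halfLength R h := le_antisymm hM (not_lt.1 h1)
    subst this
    rw [two_mul, add_sub_cancel_right, H.upperHalf_halfLength]
    exact Plane.reflect_eq_self rfl

theorem curve_of_ge {t : ℝ} (hM : halfLength R h ≤ t) (h2 : t ≤ 2 * halfLength R h) :
    curve R h r t = Plane.reflect (upperHalf R h r (2 * halfLength R h - t)) := by
  have hpos := H.halfLength_pos
  rcases h2.lt_or_eq with h1 | h1
  · rw [curve_of_mem_Ico (by linarith) h1, closedCurve, if_neg hM.not_gt]
  -- At the end of the period the fractional part wraps to 0; the formula persists because the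
  -- starting point lies on the axis of reflection.
  · have h3 := curve_periodic R h r hpos 0
    rw [zero_add] at h3
    rw [h1, h3, H.curve_of_le le_rfl hpos.le, sub_self, H.upperHalf_zero]
    exact (Plane.reflect_eq_self rfl).symm

theorem hasUnitOneSidedDerivs_curve : HasUnitOneSidedDerivs (curve R h r) := by
  have hpos := H.halfLength_pos
  have hU := H.hasUnitOneSidedDerivs_upperHalf
  refine HasUnitOneSidedDerivs.comp_fract (f := closedCurve R h r)
    (hU.ite_lt ((hU.comp_const_sub _).linearIsometry_comp _) ?_) (by linarith) ?_
  · rw [two_mul, add_sub_cancel_right, H.upperHalf_halfLength]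
    exact (Plane.reflect_eq_self rfl).symm
  · rw [closedCurve, closedCurve, if_pos hpos, if_neg (by linarith), sub_self, H.upperHalf_zero]
    exact (Plane.reflect_eq_self rfl).symm

theorem curve_injOn : Set.InjOn (curve R h r) (Set.Ico 0 (2 * halfLength R h)) := by
  have hpos := H.halfLength_pos
  -- A point common to both halves lies on the axis, which the upper half meets only at its two end
  -- times; both are excluded for 2M - t.
  have hmixed : ∀ s t, 0 ≤ s → s ≤ halfLength R h → halfLength R h < t → t < 2 * halfLength R h →
      curve R h r s ≠ curve R h r t := by
    intro s t h1 h2 h3 h4 heq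
    rw [H.curve_of_le h1 h2, H.curve_of_ge h3.le h4.le] at heq
    have h5 := H.upperHalf_one_nonneg h1 h2
    have h6 := H.upperHalf_one_nonneg (t := 2 * halfLength R h - t) (by linarith) (by linarith)
    rw [heq, Plane.reflect_one] at h5
    rcases H.eq_zero_or_eq_of_upperHalf_one_eq_zero (t := 2 * halfLength R h - t) (by linarith)
      (by linarith) (by linarith) with h7 | h7 <;> linarith
  rintro s ⟨hs0, hs⟩ t ⟨ht0, ht⟩ heq
  rcases le_or_gt s (halfLength R h) with h1 | h1 <;>
    rcases le_or_gt t (halfLength R h) with h2 | h2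
  · rw [H.curve_of_le hs0 h1, H.curve_of_le ht0 h2] at heq
    exact H.upperHalf_injOn ⟨hs0, h1⟩ ⟨ht0, h2⟩ heq
  · exact absurd heq (hmixed s t hs0 h1 h2 ht)
  · exact absurd heq.symm (hmixed t s ht0 h2 h1 hs)
  · rw [H.curve_of_ge h1.le hs.le, H.curve_of_ge h2.le ht.le] at heq
    have := H.upperHalf_injOn ⟨by linarith, by linarith⟩ ⟨by linarith, by linarith⟩
      (Plane.reflect.injective heq)
    linarith

theorem isSimpleClosedUnitSpeed :
    IsSimpleClosedUnitSpeed (curve R h r) (2 * halfLength R h) :=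
  ⟨by linarith [H.halfLength_pos], curve_periodic R h r H.halfLength_pos, H.curve_injOn,
    H.hasUnitOneSidedDerivs_curve.hasUnitSpeedOn⟩

theorem mem_range_curve_iff {x : Plane} :
    x ∈ Set.range (curve R h r) ↔ IsOnOutline R h r x := by
  have hpos := H.halfLength_pos
  constructor
  · intro hx
    rw [← (curve_periodic R h r hpos).image_Icc (by linarith) 0, zero_add] at hx
    obtain ⟨t, ⟨h0, h1⟩, rfl⟩ := hx
    rcases le_total t (halfLength R h) with h2 | h2
    · rw [H.curve_of_le h0 h2]
      exact H.isOnOutline_upperHalf h0 h2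
    · rw [H.curve_of_ge h2 h1, isOnOutline_reflect]
      exact H.isOnOutline_upperHalf (by linarith) (by linarith)
  · intro hx
    rcases le_total 0 (x 1) with h1 | h1
    · obtain ⟨t, h0, hM, rfl⟩ := H.exists_upperHalf_eq hx h1
      exact ⟨t, H.curve_of_le h0 hM⟩
    · obtain ⟨t, h0, hM, ht⟩ := H.exists_upperHalf_eq (isOnOutline_reflect.2 hx)
        (by rw [Plane.reflect_one]; linarith)
      refine ⟨2 * halfLength R h - t, ?_⟩
      rw [H.curve_of_ge (by linarith) (by linarith), sub_sub_cancel, ht, Plane.reflect_reflect]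

end IsShape

/-! ### Antipodal chords and the total diameter. -/

theorem IsOnOutline.norm_le {R h r : ℝ} (H : IsShape R h r) {x : Plane}
    (hx : IsOnOutline R h r x) (h0 : 0 ≤ x 0) : ‖x‖ ≤ R := by
  have h1 := H.gap_pos
  have h2 := H.gap_lt
  have h3 := H.lt
  have hb : (0 : ℝ) ≤ R := H.big_pos.le
  refine (sq_le_sq₀ (norm_nonneg _) hb).1 ?_
  rw [Plane.norm_sq]
  have hy : |x 1| ≤ R → x 0 ≤ 0 → x 0 ^ 2 + x 1 ^ 2 ≤ R ^ 2 := by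
    intro hy hle
    have : x 0 = 0 := le_antisymm hle h0
    have := sq_le_sq' (by linarith [abs_nonneg (x 1)]) hy
    rw [sq_abs] at this
    nlinarith
  rcases hx with ⟨_, b, c⟩ | ⟨_, b⟩ | ⟨a, _, _⟩ | ⟨_, b, c⟩ | ⟨a, _, c⟩ | ⟨_, b⟩
  · exact hy c.le b
  · exact b.le
  · linarith
  · exact hy (by linarith) b
  · exact hy (by linarith) a.le
  · rw [b]; exact pow_le_pow_left₀ (by linarith) h3.le 2

theorem upperHalf_side {R h r t : ℝ} (h1 : Real.pi * R / 2 + 1 ≤ t)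
    (h2 : t ≤ halfLength R h - (Real.pi * R / 2 + 1)) :
    upperHalf R h r t = !₂[-1, R + (Real.pi * R / 2 + 1) - t] := by
  rw [upperHalf, if_neg (by linarith), if_neg h1.not_gt]
  rcases h2.lt_or_eq with h3 | h3
  · rw [if_pos h3]
  · rw [if_neg h3.not_lt, if_pos (by linarith), h3]
    refine Plane.ext' ?_ ?_ <;> simp [halfLength]
    ring

namespace IsShape

variable {R h r : ℝ} (H : IsShape R h r)
include H

theorem upperHalf_top {t : ℝ} (h1 : Real.pi * R / 2 ≤ t) (h2 : t ≤ Real.pi * R / 2 + 1) :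
    upperHalf R h r t = !₂[Real.pi * R / 2 - t, R] := by
  have hb := H.breaks.2.1
  rw [upperHalf, if_neg h1.not_gt]
  rcases h2.lt_or_eq with h3 | h3
  · rw [if_pos h3]
  · rw [if_neg h3.not_lt, if_pos (by linarith)]
    exact Plane.ext' (by simp [h3]) (by simp [h3])

theorem upperHalf_bottom {t : ℝ} (h1 : halfLength R h - (Real.pi * R / 2 + 1) ≤ t)
    (h2 : t ≤ halfLength R h - Real.pi * R / 2) :
    upperHalf R h r t = !₂[t - (halfLength R h - Real.pi * R / 2), h] := by
  obtain ⟨b1, b2, b3, b4, -⟩ := H.breaks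
  have hr := H.gap_lt
  rw [upperHalf, if_neg (by linarith), if_neg (by linarith), if_neg h1.not_gt]
  rcases h2.lt_or_eq with h3 | h3
  · rw [if_pos h3]
  · rw [if_neg h3.not_lt, if_pos (by linarith)]
    exact Plane.ext' (by simp [h3]) (by simp [h3])

theorem curve_add_halfLength {t : ℝ} (h0 : 0 ≤ t) (hM : t ≤ halfLength R h) :
    curve R h r (t + halfLength R h) = Plane.reflect (upperHalf R h r (halfLength R h - t)) := by
  rw [H.curve_of_ge (by linarith) (by linarith)]
  congr 2
  ring

/-- The antipodal chords with both ends on the rectangular parts are vertical. -/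
theorem chord_eq {t : ℝ} (h1 : Real.pi * R / 2 ≤ t) (h2 : t ≤ halfLength R h - Real.pi * R / 2) :
    ‖curve R h r (t + halfLength R h) - curve R h r t‖ = R + h := by
  obtain ⟨b1, b2, b3, b4, -⟩ := H.breaks
  have hhalf : halfLength R h = Real.pi * R + 2 + (R - h) := rfl
  have hpos : 0 ≤ R + h := by linarith [H.gap_pos, H.big_pos]
  rw [H.curve_add_halfLength (by linarith) (by linarith),
    H.curve_of_le (by linarith) (by linarith)]
  refine (sq_eq_sq₀ (norm_nonneg _) hpos).1 ?_
  rw [Plane.norm_sq]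
  simp only [PiLp.sub_apply, Plane.reflect_zero, Plane.reflect_one]
  -- The substitution t ↦ M - t exchanges top and bottom at equal abscissa. It maps the left side to
  -- itself, where the two heights add up to R + h, so after reflection the chord has that length
  -- too.
  rcases le_total t (Real.pi * R / 2 + 1) with h3 | h3
  · rw [H.upperHalf_top h1 h3, H.upperHalf_bottom (by linarith) (by linarith)]
    simp only [Matrix.cons_val_zero, Matrix.cons_val_one, Matrix.cons_val_fin_one]
    ring
  · rcases le_total t (halfLength R h - (Real.pi * R / 2 + 1)) with h4 | h4
    · rw [upperHalf_side h3 h4, upperHalf_side (by linarith) (by linarith)]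
      simp only [Matrix.cons_val_zero, Matrix.cons_val_one, Matrix.cons_val_fin_one]
      rw [hhalf]
      ring
    · rw [H.upperHalf_bottom h4 h2, H.upperHalf_top (by linarith) (by linarith)]
      simp only [Matrix.cons_val_zero, Matrix.cons_val_one, Matrix.cons_val_fin_one]
      ring

theorem norm_upperHalf_le {t : ℝ} (h0 : 0 ≤ t) (hM : t ≤ halfLength R h)
    (ht : t ≤ Real.pi * R / 2 ∨ halfLength R h - Real.pi * R / 2 ≤ t) :
    ‖upperHalf R h r t‖ ≤ R := by
  refine (H.isOnOutline_upperHalf h0 hM).norm_le H ?_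
  obtain ⟨b1, b2, b3, b4, -⟩ := H.breaks
  have hR := H.big_pos
  have hr := H.small_pos
  have hhalf : halfLength R h = Real.pi * R + 2 + (R - h) := rfl
  have hlt := H.gap_lt_big
  rcases H.upperHalf_cases h0 hM with ⟨θ, h1, h2, h3, h4⟩ | ⟨s, h1, h2, h3, h4⟩ |
    ⟨s, h1, h2, h3, h4⟩ | ⟨s, h1, h2, h3, h4⟩ | ⟨s, h1, h2, h3, h4⟩ | ⟨θ, h1, h2, h3, h4⟩ <;>
  rw [h4] <;> simp only [Matrix.cons_val_zero]
  · exact mul_nonneg hR.le (Real.cos_nonneg_of_neg_pi_div_two_le_of_le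
      (by linarith [Real.pi_pos]) h2.le)
  · rcases ht with ht | ht <;> linarith
  · rcases ht with ht | ht <;> linarith
  · rcases ht with ht | ht <;> linarith
  · exact le_rfl
  · exact mul_nonneg hr.le (Real.cos_nonneg_of_neg_pi_div_two_le_of_le
      (by linarith [Real.pi_pos]) h2)

/-- The condition on t is invariant under t ↦ M - t, so both ends of the chord lie in the disc of
radius R. -/
theorem chord_le {t : ℝ} (h0 : 0 ≤ t) (hM : t ≤ halfLength R h)
    (ht : t ≤ Real.pi * R / 2 ∨ halfLength R h - Real.pi * R / 2 ≤ t) :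
    ‖curve R h r (t + halfLength R h) - curve R h r t‖ ≤ 2 * R := by
  rw [H.curve_add_halfLength h0 hM, H.curve_of_le h0 hM]
  refine (norm_sub_le _ _).trans ?_
  rw [LinearIsometry.norm_map]
  have h1 := H.norm_upperHalf_le h0 hM ht
  have h2 := H.norm_upperHalf_le (t := halfLength R h - t) (by linarith) (by linarith)
    (ht.symm.imp (fun h => by linarith) fun h => by linarith)
  linarith

theorem totalDiameter_bounds :
    2 * ((R + h) * (2 + (R - h))) ≤ totalDiameter (curve R h r) (2 * halfLength R h) ∧
    totalDiameter (curve R h r) (2 * halfLength R h) ≤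
      2 * ((R + h) * (2 + (R - h))) + 4 * Real.pi * R ^ 2 := by
  obtain ⟨b1, b2, b3, b4, b5⟩ := H.breaks
  set a := Real.pi * R / 2 with ha
  set M := halfLength R h with hM
  have hhalf : M = Real.pi * R + 2 + (R - h) := rfl
  set c : ℝ → ℝ := fun t => ‖curve R h r (t + M) - curve R h r t‖ with hc
  have hcont : Continuous c := by
    have := H.hasUnitOneSidedDerivs_curve.continuous
    exact ((this.comp (by fun_prop)).sub this).norm
  have hint : ∀ u v : ℝ, IntervalIntegrable c volume u v := fun u v => hcont.intervalIntegrable u v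
  -- Half a period exchanges the two ends of a chord, so the integral over the period is twice that
  -- over [0, M].
  have hper : Function.Periodic c M := by
    intro t
    have := curve_periodic R h r b5 t
    simp only [hc]
    rw [show t + M + M = t + 2 * M by ring, this, norm_sub_rev]
  have htd : totalDiameter (curve R h r) (2 * M) =
      2 * ((∫ t in (0 : ℝ)..a, c t) + (∫ t in a..(M - a), c t) + ∫ t in (M - a)..M, c t) := by
    have h1 : totalDiameter (curve R h r) (2 * M) = ∫ t in (0 : ℝ)..(2 * M), c t := by
      unfold totalDiameter
      simp only [hc, mul_div_cancel_left₀ M (two_ne_zero' ℝ)]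
    have h2 : ∫ t in M..(2 * M), c t = ∫ t in (0 : ℝ)..M, c t := by
      have := hper.intervalIntegral_add_eq M 0
      rwa [← two_mul, zero_add] at this
    rw [h1, ← intervalIntegral.integral_add_adjacent_intervals (hint 0 M) (hint M (2 * M)), h2,
      intervalIntegral.integral_add_adjacent_intervals (hint 0 a) (hint a (M - a)),
      intervalIntegral.integral_add_adjacent_intervals (hint 0 (M - a)) (hint (M - a) M)]
    ring
  have hmid : ∫ t in a..(M - a), c t = (R + h) * (2 + (R - h)) := by
    have : ∫ t in a..(M - a), c t = ∫ t in a..(M - a), (R + h) := by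
      refine intervalIntegral.integral_congr fun t ht => ?_
      rw [Set.uIcc_of_le (by linarith)] at ht
      exact H.chord_eq ht.1 ht.2
    rw [this, intervalIntegral.integral_const, smul_eq_mul, hhalf, ha]
    ring
  have hn1 : 0 ≤ ∫ t in (0 : ℝ)..a, c t :=
    intervalIntegral.integral_nonneg b1.le fun t _ => norm_nonneg _
  have hn2 : 0 ≤ ∫ t in (M - a)..M, c t :=
    intervalIntegral.integral_nonneg (by linarith) fun t _ => norm_nonneg _
  have hu1 : ∫ t in (0 : ℝ)..a, c t ≤ a * (2 * R) := by
    have := intervalIntegral.integral_mono_on b1.le (hint 0 a)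
      (intervalIntegrable_const (c := 2 * R))
      fun t ht => H.chord_le ht.1 (by linarith [ht.2]) (Or.inl ht.2)
    rwa [intervalIntegral.integral_const, smul_eq_mul, sub_zero] at this
  have hu2 : ∫ t in (M - a)..M, c t ≤ a * (2 * R) := by
    have := intervalIntegral.integral_mono_on (by linarith) (hint (M - a) M)
      (intervalIntegrable_const (c := 2 * R))
      fun t ht => H.chord_le (by linarith [ht.1]) ht.2 (Or.inr ht.1)
    rwa [intervalIntegral.integral_const, smul_eq_mul, sub_sub_cancel] at this
  have haR : a * (2 * R) = Real.pi * R ^ 2 := by rw [ha]; ring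
  rw [htd, hmid]
  constructor <;> linarith

end IsShape

end Horseshoe

/-! ### Winding numbers about the points inside and outside the outline. -/

theorem Plane.convex_box {s t : Set ℝ} (hs : Convex ℝ s) (ht : Convex ℝ t) :
    Convex ℝ {x : Plane | x 0 ∈ s ∧ x 1 ∈ t} :=
  (hs.linear_preimage (EuclideanSpace.proj (𝕜 := ℝ) (0 : Fin 2) : Plane →L[ℝ] ℝ).toLinearMap).inter
    (ht.linear_preimage (EuclideanSpace.proj (𝕜 := ℝ) (1 : Fin 2) : Plane →L[ℝ] ℝ).toLinearMap)

namespace Horseshoe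

/-- The open region enclosed by the outline. -/
def region (R h r : ℝ) : Set Plane :=
  {x | (-1 < x 0 ∧ x 0 ≤ 0 ∧ h < |x 1| ∧ |x 1| < R ∧ (x 0 = 0 → r < |x 1|)) ∨
    (0 < x 0 ∧ r ^ 2 < x 0 ^ 2 + x 1 ^ 2 ∧ x 0 ^ 2 + x 1 ^ 2 < R ^ 2)}

namespace IsShape

variable {R h r : ℝ} (H : IsShape R h r)
include H

theorem bounds_of_isOnOutline {x : Plane} (hx : IsOnOutline R h r x) : -1 ≤ x 0 ∧ |x 1| ≤ R := by
  have h1 := H.gap_pos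
  have h2 := H.gap_lt
  have h3 := H.lt
  have hcirc : ∀ ρ, 0 ≤ ρ → ρ ≤ R → x 0 ^ 2 + x 1 ^ 2 = ρ ^ 2 → |x 1| ≤ R := by
    intro ρ h0 hρ hsq
    exact (abs_le_of_sq_le_sq (by nlinarith [sq_nonneg (x 0)]) h0).trans hρ
  rcases hx with ⟨a, b, c⟩ | ⟨a, b⟩ | ⟨a, b, c⟩ | ⟨a, b, c⟩ | ⟨a, b, c⟩ | ⟨a, b⟩
  · exact ⟨a, c.le⟩
  · exact ⟨by linarith, hcirc R (by linarith) le_rfl b⟩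
  · exact ⟨a.ge, c⟩
  · exact ⟨a, by linarith⟩
  · exact ⟨by linarith, by linarith⟩
  · exact ⟨by linarith, hcirc r (by linarith) h3.le b⟩

theorem isOnOutline_curve (t : ℝ) : IsOnOutline R h r (curve R h r t) :=
  H.mem_range_curve_iff.1 ⟨t, rfl⟩

/-- The degree about the center of the upper rectangle is one. -/
theorem hasDegree_center :
    HasDegree (fun t => ‖curve R h r t - !₂[-1 / 2, (R + h) / 2]‖⁻¹ •
      (curve R h r t - !₂[-1 / 2, (R + h) / 2])) (2 * halfLength R h) 1 := by
  obtain ⟨b1, b2, b3, b4, b5⟩ := H.breaks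
  have hh := H.gap_pos
  have hhR := H.gap_lt_big
  have hR := H.big_pos
  have hr := H.small_pos
  have hpi := Real.pi_pos
  set a := Real.pi * R / 2 with ha
  have hcs : Real.cos (-(Real.pi / 2)) = 0 ∧ Real.sin (-(Real.pi / 2)) = -1 := by simp
  refine hasDegree_of_ne_opposite (by linarith) H.hasUnitOneSidedDerivs_curve.continuous
    (curve_periodic R h r b5)
    -- The rough angle points straight down except on the top side, where it makes one full turn.
    -- Only there does the curve pass straight above the centre, and at that moment, halfway along,
    -- the angle is π/2 and points up as well.
    (ψ := fun t => -(Real.pi / 2) + max 0 (min (t - a) 1) * (2 * Real.pi)) (by fun_prop) ?_ ?_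
  · rw [max_eq_left (b := min (0 - a) 1) ((min_le_left _ _).trans (by linarith)),
      min_eq_right (by linarith), max_eq_right zero_le_one]
    push_cast
    ring
  · rintro t ⟨h0, h2⟩
    change 0 < (curve R h r t 0 - -1 / 2) * _ + (curve R h r t 1 - (R + h) / 2) * _ ∨
      (curve R h r t 1 - (R + h) / 2) * _ - (curve R h r t 0 - -1 / 2) * _ ≠ 0
    rcases le_or_gt t a with h3 | h3
    · rw [max_eq_left ((min_le_left _ _).trans (by linarith)), zero_mul, add_zero, hcs.1, hcs.2]
      right
      have h4 : 0 ≤ curve R h r t 0 := by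
        rw [H.curve_of_le h0 (by linarith)]
        rcases h3.lt_or_eq with h5 | h5
        · rw [upperHalf, if_pos h5]
          refine mul_nonneg hR.le (Real.cos_nonneg_of_neg_pi_div_two_le_of_le ?_ ?_)
          · have : 0 ≤ t / R := by positivity
            linarith
          · rw [div_le_iff₀ hR]; linarith
        · rw [H.upperHalf_top h5.ge (by linarith)]
          simp [h5, ha]
      have : 0 < curve R h r t 0 + 1 / 2 := by linarith
      intro hzero
      linarith
    · rcases le_or_gt t (a + 1) with h4 | h4
      · set s := t - a with hs
        have hψ : -(Real.pi / 2) + max 0 (min s 1) * (2 * Real.pi) =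
            2 * Real.pi * s - Real.pi / 2 := by
          rw [min_eq_left (by linarith), max_eq_right (by linarith)]; ring
        rw [hψ, Real.cos_sub_pi_div_two, Real.sin_sub_pi_div_two, H.curve_of_le h0 (by linarith),
          H.upperHalf_top h3.le h4]
        simp only [Matrix.cons_val_zero, Matrix.cons_val_one, Matrix.cons_val_fin_one]
        set S := Real.sin (2 * Real.pi * s) with hS
        set C := Real.cos (2 * Real.pi * s) with hC
        have hSC : S ^ 2 + C ^ 2 = 1 := Real.sin_sq_add_cos_sq _
        have hg0 : a - t - -1 / 2 = 1 / 2 - s := by rw [hs]; ring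
        have hg1 : R - (R + h) / 2 = (R - h) / 2 := by ring
        rw [hg0, hg1]
        by_contra! hcon
        obtain ⟨hF, hz⟩ := hcon
        set F := (1 / 2 - s) * S + (R - h) / 2 * -C with hFdef
        -- If the directions were opposite, γ - x would be F times the unit vector (S, -C) with F ≤
        -- 0. The signs of 1/2 - s and S agree on either side of the midpoint, which rules this out.
        have e0 : 1 / 2 - s = F * S := by
          linear_combination (-(1 / 2 - s)) * hSC - (-C) * hz
        have e1 : (R - h) / 2 = -(F * C) := by
          linear_combination (-((R - h) / 2)) * hSC + S * hz
        have hne : s ≠ 1 / 2 := by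
          intro hs2
          have : C = -1 := by
            rw [hC, hs2, show 2 * Real.pi * (1 / 2) = Real.pi by ring, Real.cos_pi]
          rw [this] at e1
          linarith
        rcases hne.lt_or_gt with hs2 | hs2
        · have : 0 ≤ S := Real.sin_nonneg_of_nonneg_of_le_pi
            (mul_nonneg (by linarith) (by linarith)) (by nlinarith)
          have := mul_nonpos_of_nonpos_of_nonneg hF this
          linarith
        · have : 0 ≤ Real.sin (2 * Real.pi * s - Real.pi) :=
            Real.sin_nonneg_of_nonneg_of_le_pi (by nlinarith) (by nlinarith)
          rw [Real.sin_sub_pi] at this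
          have := mul_nonneg_of_nonpos_of_nonpos hF (show S ≤ 0 by linarith)
          linarith
      · have hψ : -(Real.pi / 2) + max 0 (min (t - a) 1) * (2 * Real.pi) =
            -(Real.pi / 2) + 2 * Real.pi := by
          rw [min_eq_right (by linarith), max_eq_right zero_le_one, one_mul]
        rw [hψ, Real.cos_add_two_pi, Real.sin_add_two_pi, hcs.1, hcs.2]
        rcases le_total t (halfLength R h) with h5 | h5
        · rw [H.curve_of_le h0 h5]
          rcases H.upperHalf_cases h0 h5 with ⟨θ, t1, t2, t3, t4⟩ | ⟨s, t1, t2, t3, t4⟩ |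
            ⟨s, t1, t2, t3, t4⟩ | ⟨s, t1, t2, t3, t4⟩ | ⟨s, t1, t2, t3, t4⟩ | ⟨θ, t1, t2, t3, t4⟩ <;>
          rw [t4] <;> simp only [Matrix.cons_val_zero, Matrix.cons_val_one, Matrix.cons_val_fin_one]
          · right
            have := mul_nonneg hR.le (Real.cos_nonneg_of_neg_pi_div_two_le_of_le
              (by linarith) t2.le)
            intro hzero
            linarith
          · linarith
          · right; norm_num
          · left; linarith
          · right; norm_num
          · right
            have := mul_nonneg hr.le (Real.cos_nonneg_of_neg_pi_div_two_le_of_le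
              (by linarith) t2)
            intro hzero
            linarith
        · left
          rw [H.curve_of_ge h5 h2, Plane.reflect_one]
          have := H.upperHalf_one_nonneg (t := 2 * halfLength R h - t) (by linarith) (by linarith)
          linarith

theorem hasDegree_of_isPreconnected {S : Set Plane} (hS : IsPreconnected S)
    (hSγ : ∀ x ∈ S, ¬IsOnOutline R h r x) {x y : Plane} (hxS : x ∈ S) (hyS : y ∈ S) {k : ℤ}
    (hx : HasDegree (fun t => ‖curve R h r t - x‖⁻¹ • (curve R h r t - x)) (2 * halfLength R h) k) :
    HasDegree (fun t => ‖curve R h r t - y‖⁻¹ • (curve R h r t - y)) (2 * halfLength R h) k :=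
  HasDegree.of_isPreconnected (by linarith [H.halfLength_pos])
    H.hasUnitOneSidedDerivs_curve.continuous (curve_periodic R h r H.halfLength_pos) hS
    (Set.disjoint_left.2 fun z hz hz' => hSγ z hz (H.mem_range_curve_iff.1 hz')) hxS hyS hx

theorem not_isOnOutline_of_mem_region {x : Plane} (hx : x ∈ region R h r) :
    ¬IsOnOutline R h r x := by
  have h1 := H.gap_pos
  have h2 := H.gap_lt
  have h3 := H.lt
  have hsq : r ^ 2 < R ^ 2 := pow_lt_pow_left₀ h3 (by linarith) two_ne_zero
  intro ho
  rcases hx with ⟨x1, x2, x3, x4, x5⟩ | ⟨x1, x2, x3⟩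
  · rcases ho with ⟨a, b, c⟩ | ⟨a, b⟩ | ⟨a, b, c⟩ | ⟨a, b, c⟩ | ⟨a, b, c⟩ | ⟨a, b⟩
    · exact x4.ne c
    · have : x 0 = 0 := le_antisymm x2 a
      have hlt := sq_lt_sq' (by linarith [abs_nonneg (x 1)]) x4
      rw [sq_abs] at hlt
      rw [this] at b
      linarith
    · linarith
    · exact x3.ne' c
    · linarith [x5 a]
    · have : x 0 = 0 := le_antisymm x2 a
      have hlt := sq_lt_sq' (by linarith) (x5 this)
      rw [sq_abs] at hlt
      rw [this] at b
      linarith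
  · rcases ho with ⟨a, b, c⟩ | ⟨a, b⟩ | ⟨a, b, c⟩ | ⟨a, b, c⟩ | ⟨a, b, c⟩ | ⟨a, b⟩ <;> linarith

/-- Degree one spreads from the centre through a chain of connected pieces of the region: upper
rectangle, its right end, semicircular arcs, right end of the lower rectangle, lower rectangle. -/
theorem hasDegree_one_of_mem_region {x : Plane} (hx : x ∈ region R h r) :
    HasDegree (fun t => ‖curve R h r t - x‖⁻¹ • (curve R h r t - x)) (2 * halfLength R h) 1 := by
  have hh := H.gap_pos
  have hhr := H.gap_lt
  have hrR := H.lt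
  have hr := H.small_pos
  have hR := H.big_pos
  set P : Plane → Prop := fun x =>
    HasDegree (fun t => ‖curve R h r t - x‖⁻¹ • (curve R h r t - x)) (2 * halfLength R h) 1 with hP
  have hbox : ∀ s t : Set ℝ, Convex ℝ s → Convex ℝ t →
      (∀ x : Plane, x 0 ∈ s → x 1 ∈ t → x ∈ region R h r) →
      ∀ x y : Plane, x 0 ∈ s → x 1 ∈ t → y 0 ∈ s → y 1 ∈ t → P x → P y := by
    intro s t hs ht hst x y x0 x1 y0 y1 hx
    exact H.hasDegree_of_isPreconnected (Plane.convex_box hs ht).isPreconnected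
      (fun z hz => H.not_isOnOutline_of_mem_region (hst z hz.1 hz.2)) ⟨x0, x1⟩ ⟨y0, y1⟩ hx
  set q := (r + R) / 2 with hq
  have top : ∀ x : Plane, x 0 ∈ Set.Ioo (-1 : ℝ) 0 → x 1 ∈ Set.Ioo h R → P x := by
    intro x h0 h1
    refine hbox _ _ (convex_Ioo (-1) 0) (convex_Ioo h R) (fun z z0 z1 => Or.inl ?_)
      !₂[-1 / 2, (R + h) / 2] x (by norm_num) ⟨?_, ?_⟩ h0 h1 H.hasDegree_center
    · rw [abs_of_pos (hh.trans z1.1)]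
      exact ⟨z0.1, z0.2.le, z1.1, z1.2, fun h => absurd h z0.2.ne⟩
    · rw [Plane.mk_one]; linarith
    · rw [Plane.mk_one]; linarith
  -- The box now includes the line x 0 = 0, at heights between r and R, and so links the open
  -- rectangle to the arcs.
  have topEnd : ∀ x : Plane, x 0 ∈ Set.Ioc (-1 : ℝ) 0 → x 1 ∈ Set.Ioo r R → P x := by
    intro x h0 h1
    refine hbox _ _ (convex_Ioc (-1) 0) (convex_Ioo r R) (fun z z0 z1 => Or.inl ?_)
      !₂[-1 / 2, q] x (by norm_num) ⟨?_, ?_⟩ h0 h1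
      (top _ (by norm_num) ⟨?_, ?_⟩)
    · rw [abs_of_pos (hr.trans z1.1)]
      exact ⟨z0.1, z0.2, hhr.trans z1.1, z1.2, fun _ => z1.1⟩
    all_goals rw [Plane.mk_one]; linarith
  have arc : ∀ (ρ : ℝ), r < ρ → ρ < R → ∀ x : Plane, 0 ≤ x 0 → x 0 ^ 2 + x 1 ^ 2 = ρ ^ 2 → P x := by
    intro ρ h1 h2 x hx0 hx1
    have hρ := hr.trans h1
    have hcont : Continuous fun θ : ℝ => (!₂[ρ * Real.cos θ, ρ * Real.sin θ] : Plane) :=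
      continuous_iff_continuousAt.2 fun θ => (Plane.hasDerivAt
        ((Real.hasDerivAt_cos θ).const_mul ρ) ((Real.hasDerivAt_sin θ).const_mul ρ)).continuousAt
    refine H.hasDegree_of_isPreconnected (S := (fun θ : ℝ =>
        (!₂[ρ * Real.cos θ, ρ * Real.sin θ] : Plane)) '' Set.Icc (-(Real.pi / 2)) (Real.pi / 2))
      (isPreconnected_Icc.image _ hcont.continuousOn) ?_ (x := !₂[0, ρ]) ?_ ?_
      (topEnd _ (by norm_num) ⟨h1, h2⟩)
    · rintro z ⟨θ, ⟨t1, t2⟩, rfl⟩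
      apply H.not_isOnOutline_of_mem_region
      have hc := Real.cos_nonneg_of_neg_pi_div_two_le_of_le t1 t2
      have hsc := Real.sin_sq_add_cos_sq θ
      simp only [region, Set.mem_ofPred_eq, Matrix.cons_val_zero, Matrix.cons_val_one,
        Matrix.cons_val_fin_one]
      have hsum : (ρ * Real.cos θ) ^ 2 + (ρ * Real.sin θ) ^ 2 = ρ ^ 2 := by
        linear_combination ρ ^ 2 * hsc
      rcases hc.lt_or_eq with h5 | h5
      · refine Or.inr ⟨mul_pos hρ h5, ?_, ?_⟩ <;> rw [hsum]
        · exact pow_lt_pow_left₀ h1 hr.le two_ne_zero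
        · exact pow_lt_pow_left₀ h2 hρ.le two_ne_zero
      · have habs : |ρ * Real.sin θ| = ρ := by
          rw [← abs_of_pos hρ, ← sq_eq_sq_iff_abs_eq_abs, abs_of_pos hρ]
          rw [← h5] at hsum
          linarith
        rw [habs, ← h5, mul_zero]
        exact Or.inl ⟨by norm_num, le_rfl, hhr.trans h1, h2, fun _ => h1⟩
    · exact ⟨Real.pi / 2, ⟨by linarith [Real.pi_pos], le_rfl⟩, Plane.ext' (by simp) (by simp)⟩
    · obtain ⟨θ, t1, t2, -, t3, t4⟩ := Plane.exists_angle hρ hx0 hx1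
      exact ⟨θ, ⟨t1, t2⟩, Plane.ext' t3.symm t4.symm⟩
  have botEnd : ∀ x : Plane, x 0 ∈ Set.Ioc (-1 : ℝ) 0 → x 1 ∈ Set.Ioo (-R) (-r) → P x := by
    intro x h0 h1
    refine hbox _ _ (convex_Ioc (-1) 0) (convex_Ioo (-R) (-r)) (fun z z0 z1 => Or.inl ?_)
      !₂[0, -q] x (by norm_num) ⟨?_, ?_⟩ h0 h1
      (arc q (by linarith) (by linarith) _ le_rfl ?_)
    · rw [abs_of_neg (by linarith [z1.2])]
      exact ⟨z0.1, z0.2, by linarith [z1.2], by linarith [z1.1], fun _ => by linarith [z1.2]⟩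
    · rw [Plane.mk_one]; linarith
    · rw [Plane.mk_one]; linarith
    · rw [Plane.mk_zero, Plane.mk_one]; ring
  have bot : ∀ x : Plane, x 0 ∈ Set.Ioo (-1 : ℝ) 0 → x 1 ∈ Set.Ioo (-R) (-h) → P x := by
    intro x h0 h1
    refine hbox _ _ (convex_Ioo (-1) 0) (convex_Ioo (-R) (-h)) (fun z z0 z1 => Or.inl ?_)
      !₂[-1 / 2, -q] x (by norm_num) ⟨?_, ?_⟩ h0 h1
      (botEnd _ (by norm_num) ⟨?_, ?_⟩)
    · rw [abs_of_neg (by linarith [z1.2])]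
      exact ⟨z0.1, z0.2.le, by linarith [z1.2], by linarith [z1.1], fun h => absurd h z0.2.ne⟩
    all_goals rw [Plane.mk_one]; linarith
  rcases hx with ⟨x1, x2, x3, x4, x5⟩ | ⟨x1, x2, x3⟩
  · rcases x2.lt_or_eq with hlt | heq
    · rcases abs_cases (x 1) with ⟨ha, hs⟩ | ⟨ha, hs⟩ <;> rw [ha] at x3 x4
      · exact top x ⟨x1, hlt⟩ ⟨x3, x4⟩
      · exact bot x ⟨x1, hlt⟩ ⟨by linarith, by linarith⟩
    · have x6 := x5 heq
      rcases abs_cases (x 1) with ⟨ha, hs⟩ | ⟨ha, hs⟩ <;> rw [ha] at x4 x6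
      · exact topEnd x ⟨x1, x2⟩ ⟨x6, x4⟩
      · exact botEnd x ⟨x1, x2⟩ ⟨by linarith, by linarith⟩
  · have hnn : 0 ≤ x 0 ^ 2 + x 1 ^ 2 := by positivity
    refine arc (Real.sqrt (x 0 ^ 2 + x 1 ^ 2)) ?_ ?_ x x1.le (Real.sq_sqrt hnn).symm
    · exact Real.lt_sqrt_of_sq_lt x2
    · exact (Real.sqrt_lt' hR).2 x3

/-- The gap between the rectangles is open to the left: the leftward horizontal ray from x misses
the curve, since outline points at this height lie on the semicircles with positive abscissa. -/
theorem hasDegree_zero_of_strip {x : Plane} (h0 : x 0 ≤ 0) (h1 : |x 1| < h) :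
    HasDegree (fun t => ‖curve R h r t - x‖⁻¹ • (curve R h r t - x)) (2 * halfLength R h) 0 := by
  have hh := H.gap_pos
  have hhr := H.gap_lt
  have hrR := H.lt
  refine hasDegree_zero_of_ray (by linarith [H.halfLength_pos])
    H.hasUnitOneSidedDerivs_curve.continuous (curve_periodic R h r H.halfLength_pos) 0 fun t => ?_
  rw [Real.cos_zero, Real.sin_zero, mul_one, mul_zero, add_zero, mul_one, mul_zero, sub_zero]
  by_cases heq : curve R h r t 1 = x 1
  · left
    have hcirc : ∀ ρ, h < ρ → 0 ≤ curve R h r t 0 →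
        curve R h r t 0 ^ 2 + curve R h r t 1 ^ 2 = ρ ^ 2 → 0 < curve R h r t 0 - x 0 := by
      intro ρ hρ hc hsq
      have : curve R h r t 0 ≠ 0 := by
        intro hz
        have hlt := sq_lt_sq' (by linarith [abs_nonneg (x 1)]) (h1.trans hρ)
        rw [sq_abs] at hlt
        rw [hz, heq] at hsq
        linarith
      linarith [lt_of_le_of_ne hc this.symm]
    have ho := H.isOnOutline_curve t
    unfold IsOnOutline at ho
    rw [← heq] at h1
    rcases ho with ⟨a, b, c⟩ | ⟨a, b⟩ | ⟨a, b, c⟩ | ⟨a, b, c⟩ | ⟨a, b, c⟩ | ⟨a, b⟩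
    · linarith
    · exact hcirc R (by linarith) a b
    · linarith
    · linarith
    · linarith
    · exact hcirc r hhr a b
  · exact Or.inr (sub_ne_zero.2 heq)

/-- A half-plane separates points beyond the left, top or bottom bounds, or beyond the large
semicircle; the strip has its ray; points inside the small semicircle are joined to the origin,
which lies in the strip. Everything else is in the region or on the outline. -/
theorem hasDegree_zero_of_notMem {x : Plane} (hx : x ∉ region R h r)
    (ho : ¬IsOnOutline R h r x) :
    HasDegree (fun t => ‖curve R h r t - x‖⁻¹ • (curve R h r t - x)) (2 * halfLength R h) 0 := by
  have hh := H.gap_pos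
  have hhr := H.gap_lt
  have hrR := H.lt
  have hR := H.big_pos
  have hM : 0 < 2 * halfLength R h := by linarith [H.halfLength_pos]
  have hcont := H.hasUnitOneSidedDerivs_curve.continuous
  have hper := curve_periodic R h r H.halfLength_pos
  have hb := fun t => H.bounds_of_isOnOutline (H.isOnOutline_curve t)
  rcases lt_or_ge (x 0) (-1) with h1 | h1
  · refine hasDegree_zero_of_halfPlane hM hcont hper 1 0 fun t => ?_
    linarith [(hb t).1]
  rcases lt_or_ge R (x 1) with h2 | h2
  · refine hasDegree_zero_of_halfPlane hM hcont hper 0 (-1) fun t => ?_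
    linarith [(abs_le.1 (hb t).2).2]
  rcases lt_or_ge (x 1) (-R) with h3 | h3
  · refine hasDegree_zero_of_halfPlane hM hcont hper 0 1 fun t => ?_
    linarith [(abs_le.1 (hb t).2).1]
  rcases le_or_gt (x 0) 0 with h0 | h0
  · rcases lt_or_ge |x 1| h with h4 | h4
    · exact H.hasDegree_zero_of_strip h0 h4
    · exfalso
      have habs : |x 1| ≤ R := abs_le.2 ⟨h3, h2⟩
      rcases h4.lt_or_eq with h5 | h5
      · rcases habs.lt_or_eq with h6 | h6
        · rcases h1.lt_or_eq with h7 | h7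
          · refine hx (Or.inl ⟨h7, h0, h5, h6, fun h8 => ?_⟩)
            by_contra! h9
            exact ho (Or.inr (Or.inr (Or.inr (Or.inr (Or.inl ⟨h8, h4, h9⟩)))))
          · exact ho (Or.inr (Or.inr (Or.inl ⟨h7.symm, h4, habs⟩)))
        · exact ho (Or.inl ⟨h1, h0, h6⟩)
      · exact ho (Or.inr (Or.inr (Or.inr (Or.inl ⟨h1, h0, h5.symm⟩))))
  · rcases lt_or_ge (R ^ 2) (x 0 ^ 2 + x 1 ^ 2) with h4 | h4
    -- The separating line passes through x perpendicular to x. Curve points on the right lie in the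
    -- disc of radius R < ‖x‖; those on the left have negative abscissa and height at most R in
    -- absolute value.
    · refine hasDegree_zero_of_halfPlane hM hcont hper (-x 0) (-x 1) fun t => ?_
      rcases le_or_gt 0 (curve R h r t 0) with h5 | h5
      · have h6 := (H.isOnOutline_curve t).norm_le H h5
        have h7 := pow_le_pow_left₀ (norm_nonneg _) h6 2
        rw [Plane.norm_sq] at h7
        nlinarith [sq_nonneg (curve R h r t 0 - x 0), sq_nonneg (curve R h r t 1 - x 1)]
      · have h6 := sq_le_sq' (by linarith [abs_nonneg (curve R h r t 1)]) (hb t).2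
        rw [sq_abs] at h6
        nlinarith [sq_nonneg (curve R h r t 1 - x 1), mul_pos h0 (neg_pos.2 h5)]
    · rcases h4.lt_or_eq with h5 | h5
      · rcases lt_or_ge (x 0 ^ 2 + x 1 ^ 2) (r ^ 2) with h6 | h6
        · refine H.hasDegree_of_isPreconnected (S := segment ℝ 0 x)
            (convex_segment 0 x).isPreconnected ?_ (left_mem_segment ℝ 0 x)
            (right_mem_segment ℝ 0 x) (H.hasDegree_zero_of_strip (x := 0) (by simp) (by simpa))
          rw [segment_eq_image]
          rintro z ⟨s, ⟨s0, s1⟩, rfl⟩ hz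
          change IsOnOutline R h r ((1 - s) • (0 : Plane) + s • x) at hz
          rw [smul_zero, zero_add] at hz
          have z0 : (s • x) 0 = s * x 0 := rfl
          have z1 : (s • x) 1 = s * x 1 := rfl
          have hs0 : 0 ≤ s * x 0 := mul_nonneg s0 h0.le
          have hss : s ^ 2 ≤ 1 := by nlinarith
          have hlt : (s * x 0) ^ 2 + (s * x 1) ^ 2 < r ^ 2 := by
            nlinarith [sq_nonneg (x 0), sq_nonneg (x 1)]
          have hsq : r ^ 2 < R ^ 2 := pow_lt_pow_left₀ hrR (by linarith) two_ne_zero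
          have hzero : s * x 0 ≤ 0 → |s * x 1| = 0 := by
            intro hle
            rcases mul_eq_zero.1 (le_antisymm hle hs0) with h7 | h7
            · rw [h7, zero_mul, abs_zero]
            · exact absurd h7 h0.ne'
          unfold IsOnOutline at hz
          rw [z0, z1] at hz
          rcases hz with ⟨a, b, c⟩ | ⟨a, b⟩ | ⟨a, b, c⟩ | ⟨a, b, c⟩ | ⟨a, b, c⟩ | ⟨a, b⟩
          · linarith [hzero b]
          · linarith
          · linarith
          · linarith [hzero b]
          · linarith [hzero a.le]
          · linarith
        · exfalso
          rcases h6.lt_or_eq with h7 | h7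
          · exact hx (Or.inr ⟨h0, h7, h5⟩)
          · exact ho (Or.inr (Or.inr (Or.inr (Or.inr (Or.inr ⟨h0.le, h7.symm⟩)))))
      · exact absurd (Or.inr (Or.inl ⟨h0.le, h5⟩)) ho

theorem windingMod2_curve (x : Plane) :
    (windingMod2 (curve R h r) (2 * halfLength R h) x : ℝ) =
      (region R h r).indicator (fun _ => 1) x := by
  by_cases hx : x ∈ region R h r
  · rw [Set.indicator_of_mem hx,
      windingMod2_eq_one (H.hasDegree_one_of_mem_region hx) odd_one, Nat.cast_one]
  · rw [Set.indicator_of_notMem hx]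
    by_cases ho : IsOnOutline R h r x
    · rw [windingMod2_eq_zero_of_mem_range (H.mem_range_curve_iff.2 ho), Nat.cast_zero]
    · rw [windingMod2_eq_zero (H.hasDegree_zero_of_notMem hx ho) Even.zero, Nat.cast_zero]

end IsShape

end Horseshoe

/-! ### Area of the enclosed region. -/

theorem Plane.volume_box {s t : Set ℝ} (hs : MeasurableSet s) (ht : MeasurableSet t) :
    volume {x : Plane | x 0 ∈ s ∧ x 1 ∈ t} = volume s * volume t := by
  have heq : {x : Plane | x 0 ∈ s ∧ x 1 ∈ t} =
      WithLp.ofLp ⁻¹' (Set.univ.pi ![s, t] : Set (Fin 2 → ℝ)) := by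
    ext x
    simp [Set.mem_pi, Fin.forall_fin_two]
  have hmeas : MeasurableSet (Set.univ.pi ![s, t] : Set (Fin 2 → ℝ)) :=
    MeasurableSet.univ_pi fun i => by fin_cases i <;> assumption
  rw [heq, (PiLp.volume_preserving_ofLp (Fin 2)).measure_preimage hmeas.nullMeasurableSet,
    volume_pi_pi, Fin.prod_univ_two]
  rfl

/-- The open half disc and its image under x ↦ -x are disjoint, have equal measure and fit in the
disc. -/
theorem Plane.volume_halfDisc_le {ρ : ℝ} (hρ : 0 < ρ) :
    volume {x : Plane | 0 < x 0 ∧ x 0 ^ 2 + x 1 ^ 2 < ρ ^ 2} ≤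
      ENNReal.ofReal (Real.pi * ρ ^ 2 / 2) := by
  set S := {x : Plane | 0 < x 0 ∧ x 0 ^ 2 + x 1 ^ 2 < ρ ^ 2} with hS
  have hm0 : Measurable fun x : Plane => x 0 := by fun_prop
  have hm1 : Measurable fun x : Plane => x 1 := by fun_prop
  have hmeas : MeasurableSet S :=
    (measurableSet_lt measurable_const hm0).inter
      (measurableSet_lt ((hm0.pow_const 2).add (hm1.pow_const 2)) measurable_const)
  have hdisj : Disjoint S (-S) := by
    refine Set.disjoint_left.2 fun x hx hx' => ?_
    have h1 : 0 < -x 0 := hx'.1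
    linarith [hx.1]
  have hsub : S ∪ -S ⊆ Metric.ball 0 ρ := by
    have hball : ∀ x : Plane, x 0 ^ 2 + x 1 ^ 2 < ρ ^ 2 → ‖x‖ < ρ := by
      intro x hx
      rw [← Plane.norm_sq] at hx
      exact lt_of_pow_lt_pow_left₀ 2 hρ.le hx
    rintro x (hx | hx) <;> rw [mem_ball_zero_iff]
    · exact hball x hx.2
    · rw [← norm_neg]
      exact hball (-x) hx.2
  have hle : volume S + volume S ≤ ENNReal.ofReal (Real.pi * ρ ^ 2) := by
    calc volume S + volume S = volume (S ∪ -S) := by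
          rw [measure_union hdisj hmeas.neg, Measure.measure_neg]
      _ ≤ volume (Metric.ball (0 : Plane) ρ) := measure_mono hsub
      _ = ENNReal.ofReal (Real.pi * ρ ^ 2) := by
          rw [EuclideanSpace.volume_ball_fin_two, ← ENNReal.ofReal_pow hρ.le, mul_comm,
            ← ENNReal.ofReal_mul Real.pi_pos.le]
  have hne : volume S ≠ ⊤ := ne_top_of_le_ne_top ENNReal.ofReal_ne_top (le_self_add.trans hle)
  rw [← two_mul] at hle
  have h2 := ENNReal.toReal_mono ENNReal.ofReal_ne_top hle
  rw [ENNReal.toReal_mul, ENNReal.toReal_ofReal (by positivity), ENNReal.toReal_ofNat] at h2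
  rw [← ENNReal.ofReal_toReal hne]
  exact ENNReal.ofReal_le_ofReal (by linarith)

namespace Horseshoe

theorem measurableSet_region (R h r : ℝ) : MeasurableSet (region R h r) := by
  have hm0 : Measurable fun x : Plane => x 0 := by fun_prop
  have hm1 : Measurable fun x : Plane => x 1 := by fun_prop
  have hmabs : Measurable fun x : Plane => |x 1| := by fun_prop
  have hmsq : Measurable fun x : Plane => x 0 ^ 2 + x 1 ^ 2 := by fun_prop
  have hzero : MeasurableSet {x : Plane | x 0 = 0 → r < |x 1|} := by
    simp only [imp_iff_not_or]
    exact (hm0 (measurableSet_singleton 0)).compl.union (measurableSet_lt measurable_const hmabs)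
  exact ((measurableSet_lt measurable_const hm0).inter <|
    (measurableSet_le hm0 measurable_const).inter <|
    (measurableSet_lt measurable_const hmabs).inter <|
    (measurableSet_lt hmabs measurable_const).inter hzero).union
    ((measurableSet_lt measurable_const hm0).inter <|
      (measurableSet_lt measurable_const hmsq).inter (measurableSet_lt hmsq measurable_const))

namespace IsShape

variable {R h r : ℝ} (H : IsShape R h r)
include H

theorem curveArea_eq :
    curveArea (curve R h r) (2 * halfLength R h) = (volume (region R h r)).toReal := by
  unfold curveArea
  simp_rw [H.windingMod2_curve]
  rw [integral_indicator_const _ (measurableSet_region R h r), smul_eq_mul, mul_one]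
  rfl

/-- The half annulus is enlarged to a half disc: its area is of order R² and enters only the error
term. -/
theorem volume_region_le :
    volume (region R h r) ≤ ENNReal.ofReal (2 * (R - h) + Real.pi * R ^ 2 / 2) := by
  have hw : 0 ≤ R - h := by linarith [H.gap_lt_big]
  have hsub : region R h r ⊆ {x | x 0 ∈ Set.Ioc (-1 : ℝ) 0 ∧ x 1 ∈ Set.Ioo h R} ∪
      {x | x 0 ∈ Set.Ioc (-1 : ℝ) 0 ∧ x 1 ∈ Set.Ioo (-R) (-h)} ∪
      {x | 0 < x 0 ∧ x 0 ^ 2 + x 1 ^ 2 < R ^ 2} := by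
    rintro x (⟨x1, x2, x3, x4, -⟩ | ⟨x1, x2, x3⟩)
    · left
      rcases abs_cases (x 1) with ⟨ha, hs⟩ | ⟨ha, hs⟩ <;> rw [ha] at x3 x4
      · exact Or.inl ⟨⟨x1, x2⟩, x3, x4⟩
      · exact Or.inr ⟨⟨x1, x2⟩, by linarith, by linarith⟩
    · exact Or.inr ⟨x1, x3⟩
  refine (measure_mono hsub).trans ((measure_union_le _ _).trans ?_)
  refine (add_le_add (measure_union_le _ _) (Plane.volume_halfDisc_le H.big_pos)).trans ?_
  rw [Plane.volume_box measurableSet_Ioc measurableSet_Ioo,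
    Plane.volume_box measurableSet_Ioc measurableSet_Ioo, Real.volume_Ioc, Real.volume_Ioo,
    Real.volume_Ioo, ← ENNReal.ofReal_mul (by norm_num), ← ENNReal.ofReal_mul (by norm_num),
    ← ENNReal.ofReal_add (by linarith) (by linarith),
    ← ENNReal.ofReal_add (by linarith) (by positivity)]
  exact ENNReal.ofReal_le_ofReal (by linarith)

theorem le_volume_region : ENNReal.ofReal (2 * (R - h)) ≤ volume (region R h r) := by
  have hh := H.gap_pos
  have hw : 0 ≤ R - h := by linarith [H.gap_lt_big]
  have hm0 : Measurable fun x : Plane => x 0 := by fun_prop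
  have hm1 : Measurable fun x : Plane => x 1 := by fun_prop
  have hsub : {x : Plane | x 0 ∈ Set.Ioo (-1 : ℝ) 0 ∧ x 1 ∈ Set.Ioo h R} ∪
      {x | x 0 ∈ Set.Ioo (-1 : ℝ) 0 ∧ x 1 ∈ Set.Ioo (-R) (-h)} ⊆ region R h r := by
    rintro x (⟨⟨x1, x2⟩, x3, x4⟩ | ⟨⟨x1, x2⟩, x3, x4⟩) <;> left
    · rw [abs_of_pos (hh.trans x3)]
      exact ⟨x1, x2.le, x3, x4, fun h => absurd h x2.ne⟩
    · rw [abs_of_neg (by linarith)]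
      exact ⟨x1, x2.le, by linarith, by linarith, fun h => absurd h x2.ne⟩
  refine le_trans (le_of_eq ?_) (measure_mono hsub)
  rw [measure_union, Plane.volume_box measurableSet_Ioo measurableSet_Ioo,
    Plane.volume_box measurableSet_Ioo measurableSet_Ioo, Real.volume_Ioo, Real.volume_Ioo,
    Real.volume_Ioo, ← ENNReal.ofReal_mul (by norm_num), ← ENNReal.ofReal_mul (by norm_num),
    ← ENNReal.ofReal_add (by linarith) (by linarith)]
  · congr 1; ring
  · refine Set.disjoint_left.2 fun x hx hx' => ?_
    linarith [hx.2.1, hx'.2.2]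
  · exact (hm0 measurableSet_Ioo).inter (hm1 measurableSet_Ioo)

theorem curveArea_bounds :
    2 * (R - h) ≤ curveArea (curve R h r) (2 * halfLength R h) ∧
    curveArea (curve R h r) (2 * halfLength R h) ≤ 2 * (R - h) + Real.pi * R ^ 2 / 2 := by
  have hw : 0 ≤ R - h := by linarith [H.gap_lt_big]
  rw [H.curveArea_eq]
  have hle := H.volume_region_le
  have hne := ne_top_of_le_ne_top ENNReal.ofReal_ne_top hle
  exact ⟨(ENNReal.ofReal_le_iff_le_toReal hne).1 H.le_volume_region,
    ENNReal.toReal_le_of_le_ofReal (by positivity) hle⟩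

end IsShape

end Horseshoe

/-! ### The estimates in n and the limit. -/

theorem mainTheorem3 :
    ∃ (L : ℕ → ℝ) (f : ℕ → ℝ → Plane),
      (∀ n : ℕ, 1 ≤ n →
        IsSimpleClosedUnitSpeed (f n) (L n) ∧
        Set.range (f n) = Horseshoe.outline n ∧
        2 / (n : ℝ) ≤ curveArea (f n) (L n) ∧
        2 * curveArea (f n) (L n) ≤ totalDiameter (f n) (L n) ∧
        totalDiameter (f n) (L n) ≤ 2 * curveArea (f n) (L n) + 94 / (n : ℝ) ^ 2) ∧
      Tendsto (fun n => totalDiameter (f n) (L n) / curveArea (f n) (L n)) atTop (𝓝 2) ∧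
      (∀ c : ℝ, (∀ (ℓ : ℝ) (γ : ℝ → Plane), IsSimpleClosedUnitSpeed γ ℓ →
        c * curveArea γ ℓ ≤ totalDiameter γ ℓ) → c ≤ 2) ∧
      (∀ᶠ n in atTop, totalDiameter (f n) (L n) < 4 * curveArea (f n) (L n)) := by
  set R := Horseshoe.bigRadius with hR
  set h := Horseshoe.halfGap with hh
  set r := Horseshoe.smallRadius with hr
  set L : ℕ → ℝ := fun n => 2 * Horseshoe.halfLength (R n) (h n) with hL
  set f : ℕ → ℝ → Plane := fun n => Horseshoe.curve (R n) (h n) (r n) with hf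
  have main : ∀ n : ℕ, 1 ≤ n →
      IsSimpleClosedUnitSpeed (f n) (L n) ∧
      Set.range (f n) = Horseshoe.outline n ∧
      2 / (n : ℝ) ≤ curveArea (f n) (L n) ∧
      2 * curveArea (f n) (L n) ≤ totalDiameter (f n) (L n) ∧
      totalDiameter (f n) (L n) ≤ 2 * curveArea (f n) (L n) + 94 / (n : ℝ) ^ 2 := by
    intro n hn
    have H := Horseshoe.isShape hn
    obtain ⟨A1, A2⟩ := H.curveArea_bounds
    obtain ⟨T1, T2⟩ := H.totalDiameter_bounds
    have hn1 : (1 : ℝ) ≤ n := by exact_mod_cast hn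
    set y : ℝ := 1 / n with hy
    have hy0 : 0 < y := by positivity
    have hy1 : y ≤ 1 := by rw [hy, div_le_one (by linarith)]; exact hn1
    have ehh : h n = y ^ 2 / 2 := by
      rw [hh, hy, Horseshoe.halfGap]; field_simp
    have eR : R n = y + y ^ 2 / 2 := by
      rw [← ehh]; rfl
    have e2 : 2 / (n : ℝ) = 2 * y := by rw [hy]; ring
    have e94 : 94 / (n : ℝ) ^ 2 = 94 * y ^ 2 := by rw [hy]; field_simp
    have hsq : R n ^ 2 = y ^ 2 * (1 + y + y ^ 2 / 4) := by rw [eR]; ring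
    have hpoly : 1 + y + y ^ 2 / 4 ≤ 9 / 4 := by nlinarith
    have hpi := Real.pi_lt_d2
    have hpi0 := Real.pi_pos
    rw [← hR, ← hh, ← hr] at A1 A2 T1 T2
    have ew : R n - h n = y := by rw [eR, ehh]; ring
    have es : R n + h n = y + y ^ 2 := by rw [eR, ehh]; ring
    rw [ew] at A1 A2 T1 T2
    rw [es] at T1 T2
    rw [hsq] at A2 T2
    refine ⟨H.isSimpleClosedUnitSpeed, ?_, ?_, ?_, ?_⟩
    · ext x
      rw [Horseshoe.mem_outline_iff hn]
      exact H.mem_range_curve_iff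
    · rw [e2]; exact A1
    -- With y = 1/n, 2A ≤ 4y + πR², while TD ≥ 2(y + y²)(2 + y) = 4y + y²(6 + 2y). Since πR² = πy²(1
    -- + y + y²/4), this is the comparison needed.
    · have h1 : Real.pi * (1 + y + y ^ 2 / 4) ≤ 6 + 2 * y := by
        have h2 : Real.pi * (1 + y + y ^ 2 / 4) ≤ 3.15 * (1 + y + y ^ 2 / 4) :=
          mul_le_mul_of_nonneg_right hpi.le (by positivity)
        nlinarith
      have h3 := mul_le_mul_of_nonneg_left h1 (sq_nonneg y)
      change 2 * curveArea (Horseshoe.curve (R n) (h n) (r n))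
        (2 * Horseshoe.halfLength (R n) (h n)) ≤ totalDiameter _ _
      nlinarith
    · rw [e94]
      -- Gives 4πR² ≤ 36y², so TD ≤ 4y + 44y² once y³ ≤ y² is used; as 4y ≤ 2A, the constant 94
      -- leaves ample room.
      have h1 : Real.pi * (1 + y + y ^ 2 / 4) ≤ 9 := by nlinarith
      have h3 := mul_le_mul_of_nonneg_left h1 (sq_nonneg y)
      have h4 : y ^ 3 ≤ y ^ 2 := pow_le_pow_of_le_one hy0.le hy1 (by norm_num)
      change totalDiameter (Horseshoe.curve (R n) (h n) (r n))
        (2 * Horseshoe.halfLength (R n) (h n)) ≤ 2 * curveArea _ _ + _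
      nlinarith
  have hpos : ∀ n : ℕ, 1 ≤ n → 0 < curveArea (f n) (L n) := by
    intro n hn
    have hn0 : (0 : ℝ) < n := by exact_mod_cast hn
    exact lt_of_lt_of_le (by positivity) (main n hn).2.2.1
  have hlim : Tendsto (fun n => totalDiameter (f n) (L n) / curveArea (f n) (L n)) atTop (𝓝 2) := by
    have hup : Tendsto (fun n : ℕ => 2 + 47 / (n : ℝ)) atTop (𝓝 2) := by
      simpa using (tendsto_const_div_atTop_nhds_zero_nat (47 : ℝ)).const_add 2
    refine tendsto_of_tendsto_of_tendsto_of_le_of_le' tendsto_const_nhds hup ?_ ?_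
    · filter_upwards [eventually_ge_atTop 1] with n hn
      rw [le_div_iff₀ (hpos n hn)]
      exact (main n hn).2.2.2.1
    · filter_upwards [eventually_ge_atTop 1] with n hn
      obtain ⟨-, -, h1, -, h2⟩ := main n hn
      have hn0 : (0 : ℝ) < n := by exact_mod_cast hn
      rw [div_le_iff₀ (hpos n hn)]
      have h3 := mul_le_mul_of_nonneg_left h1 (show 0 ≤ 47 / (n : ℝ) by positivity)
      -- Since A ≥ 2/n, the error 94/n² is at most (47/n)A, so the ratio is at most 2 + 47/n.
      have h4 : 47 / (n : ℝ) * (2 / n) = 94 / (n : ℝ) ^ 2 := by field_simp; norm_num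
      linarith
  refine ⟨L, f, main, hlim, fun c hc => ?_, ?_⟩
  · refine ge_of_tendsto hlim ?_
    filter_upwards [eventually_ge_atTop 1] with n hn
    rw [le_div_iff₀ (hpos n hn)]
    exact hc _ _ (main n hn).1
  · filter_upwards [eventually_ge_atTop 1, hlim.eventually_lt_const (show (2 : ℝ) < 4 by norm_num)]
      with n hn h4
    rwa [div_lt_iff₀ (hpos n hn)] at h4
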